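/- **Setting.** Let $\sigma$ be a finite, non-empty relational signature all of whose relation symbols have arity at least $1$. A *$\sigma$-structure* $A$ has a finite non-empty universe $V(A)$ and a relation $R^A\subseteq V(A)^{\mathrm{ar}(R)}$ for each $R\in\sigma$, such that every element of $V(A)$ is an entry of some tuple of some relation. Let $\mathbf A=\bigcup_{R\in\sigma}R^A$. For tuples $\mathbf a\in V(A)^k$, $\mathbf b\in V(A)^\ell$ put $\mathrm{atp}(\mathbf a)=\{R\in\sigma:\mathbf a\in R^A\}$, $\mathrm{stp}(\mathbf a,\mathbf b)=\{(i,j)\in[k]\times[\ell]:a_i=b_j\}$ and $\mathrm{stp}(\mathbf a)=\mathrm{stp}(\mathbf a,\mathbf a)$. *Relational Color Refinement (RCR).* For $\mathbf a\in\mathbf A$ let $\varrho_0(\mathbf a)=(\mathrm{atp}(\mathbf a),\mathrm{stp}(\mathbf a))$ and let $\varrho_{i+1}(\mathbf a)$ be the pair of $\varrho_i(\mathbf a)$ and the multiset of all $(\mathrm{stp}(\mathbf a,\mathbf b),\varrho_i(\mathbf b))$ with $\mathbf b\in\mathbf A$ and $\mathrm{stp}(\mathbf a,\mathbf b)\neq\emptyset$.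 RCR *distinguishes* $A$ and $B$ if there are a round $i\in\mathbb N$ and a color $c$ such that the numbers of tuples of $\mathbf A$ and of tuples of $\mathbf B$ with $\varrho_i$-color $c$ differ. *Acyclicity.* A $\sigma$-structure $C$ is *acyclic* if there is a tree with vertex set $\mathbf C$ in which, for every $v\in V(C)$, the tuples of $\mathbf C$ having $v$ as an entry induce a connected subgraph. Let $\hom(C,A)$ be the number of homomorphisms from $C$ to $A$. *The logic $\mathsf{GF}(\mathsf C)$.* Formulas are built from atoms $R(x_1,\dots,x_\ell)$ and $x=y$ by $\neg$, $\wedge$ and the following rule: if $\Delta$ is an atom $R(x_1,\dots,x_\ell)$, $\psi$ is a formula with $\mathrm{free}(\psi)\subseteq\mathrm{free}(\Delta)$, $n\ge1$, and $\mathbf v$ is a tuple of distinct variables from $\mathrm{free}(\Delta)$, then $\exists^{\ge n}\mathbf v.(\Delta\wedge\psi)$ is a formula; it says that at least $n$ tuples of values for $\mathbf v$ satisfy $\Delta\wedge\psi$, and its free variables are those of $\Delta$ not in $\mathbf v$. A sentence is a formula without free variables. *The Guarded-Game.* A configuration consists of tuples $\mathbf a\in V(A)^k$, $\mathbf b\in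 V(B)^k$ for some $k\in\mathbb N$; it is *distinguishing* if $\mathrm{stp}(\mathbf a)\neq\mathrm{stp}(\mathbf b)$ or $\mathrm{atp}(a_{i_1},\dots,a_{i_\ell})\ne\mathrm{atp}(b_{i_1},\dots,b_{i_\ell})$ for some $\ell\ge1$ and $i_1,\dots,i_\ell\in[k]$. In a round, Spoiler picks $R\in\sigma$, Duplicator gives a bijection $\pi:R^A\to R^B$, and Spoiler picks $\mathbf a'\in R^A$; the new configuration is $\mathbf a',\ \mathbf b'=\pi(\mathbf a')$. Duplicator wins the round if the new configuration is not distinguishing and $\mathrm{stp}(\mathbf a,\mathbf a')=\mathrm{stp}(\mathbf b,\mathbf b')$; she loses if she cannot give a bijection. Duplicator has a $0$-round winning strategy on a configuration if it is not distinguishing; she has an $(i+1)$-round winning strategy if it is not distinguishing and, for every $R$, she can give a bijection such that, whatever $\mathbf a'$ Spoiler picks, she wins the round and has an $i$-round winning strategy on the new configuration. She *wins* on $A,B$ if, for every $i\in\mathbb N$, she has an $i$-round winning strategy on the configuration of empty tuples. **Theorem.** Let $A$ and $B$ be $\sigma$-structures. The following are equivalent. 1. RCR does not distinguish $A$ and $B$.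 2. $\hom(C,A)=\hom(C,B)$ for every acyclic $\sigma$-structure $C$. 3. $A$ and $B$ satisfy the same sentences of $\mathsf{GF}(\mathsf C)$. 4. Duplicator wins the Guarded-Game on $A,B$. -/

import Mathlib

open FirstOrder FirstOrder.Language

universe uF uR u v w

/-! Relational structures are Mathlib's first-order structures.  A finite relational signature is a
language `L` without function symbols, without relation symbols of arity `0` and with finitely many
relation symbols in total. -/

namespace RCR

section Structures

variable (L : FirstOrder.Language.{uF, uR}) (A : Type u) [L.Structure A]

/-- Tuples of arbitrary (finite) arity with entries in `A`. -/
abbrev Tuple (A : Type u) : Type u := Σ k : ℕ, (Fin k → A)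

/-- The set of all tuples that belong to some relation of the structure `A`. -/
def tuples : Set (Tuple A) := {t | ∃ R : L.Relations t.1, Structure.RelMap R t.2}

/-- Every element of the universe occurs as an entry of some tuple of some relation. -/
def Covered : Prop := ∀ x : A, ∃ t ∈ tuples L A, x ∈ Set.range t.2

variable {A}

/-- The atomic type of a tuple: the set of all relation symbols whose relation contains it. -/
def atp {k : ℕ} (a : Fin k → A) : Set (Σ n : ℕ, L.Relations n) :=
  {S | ∃ R : L.Relations k, S = ⟨k, R⟩ ∧ Structure.RelMap R a}

/-- The similarity type of two tuples: the set of all pairs of positions (counted from `0`) at which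
the entries agree. -/
def stp {A : Type u} {k l : ℕ} (a : Fin k → A) (b : Fin l → A) : Set (ℕ × ℕ) :=
  {p | ∃ (i : Fin k) (j : Fin l), p = ((i : ℕ), (j : ℕ)) ∧ a i = b j}

variable (A)

theorem tuples_finite [Finite A] [Finite (Σ k : ℕ, L.Relations k)] : (tuples L A).Finite := by
  have h : Finite (Σ S : (Σ k : ℕ, L.Relations k), (Fin S.1 → A)) := inferInstance
  refine (Set.finite_range
    (fun x : (Σ S : (Σ k : ℕ, L.Relations k), (Fin S.1 → A)) =>
      (⟨x.1.1, x.2⟩ : Tuple A))).subset ?_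
  rintro ⟨k, a⟩ ⟨R, -⟩
  exact ⟨⟨⟨k, R⟩, a⟩, rfl⟩

end Structures

/-! ### Relational Color Refinement -/

section Refinement

variable (L : FirstOrder.Language.{uF, uR})

/-- The colors that can occur in round `i`.  They do not depend on a structure, so colors of tuples
of different structures can be compared. -/
def Color : ℕ → Type uR
  | 0 => Set (Σ n : ℕ, L.Relations n) × Set (ℕ × ℕ)
  | i + 1 => Color i × Multiset (Set (ℕ × ℕ) × Color i)

variable (A : Type u) [L.Structure A] [Finite A] [Finite (Σ k : ℕ, L.Relations k)]

/-- The finite set of all tuples of the structure `A` that share an entry with `a`. -/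
noncomputable def overlapping (a : Tuple A) : Finset (Tuple A) :=
  ((tuples_finite L A).subset
    (Set.sep_subset (tuples L A) fun b => (stp a.2 b.2).Nonempty)).toFinset

/-- The color of the tuple `a` after `i` rounds of refinement. -/
noncomputable def col : (i : ℕ) → Tuple A → Color L i
  | 0, a => (atp L a.2, stp a.2 a.2)
  | i + 1, a =>
    (col i a, (overlapping L A a).val.map fun b => (stp a.2 b.2, col i b))

/-- The set of colors of round `i` that occur on tuples of `A`. -/
def cols (i : ℕ) : Set (Color L i) := col L A i '' tuples L A

/-- The number of tuples of `A` that have color `c` in round `i`. -/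
noncomputable def colorCount (i : ℕ) (c : Color L i) : ℕ :=
  {a | a ∈ tuples L A ∧ col L A i a = c}.ncard

variable (B : Type v) [L.Structure B] [Finite B]

/-- Relational Color Refinement distinguishes `A` and `B` in round `i`. -/
def DistinguishesInRound (i : ℕ) : Prop :=
  ∃ c ∈ cols L A i ∪ cols L B i, colorCount L A i c ≠ colorCount L B i c

/-- Relational Color Refinement distinguishes `A` and `B` (in some round). -/
def Distinguishes : Prop := ∃ i : ℕ, DistinguishesInRound L A B i

end Refinement

/-! ### Acyclic structures and homomorphism counts -/

section Homomorphisms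

variable (L : FirstOrder.Language.{uF, uR})

/-- `J` is a join-tree: a tree on the tuples of `C` in which, for every element `x` of the universe,
the tuples that contain `x` induce a connected subgraph. -/
def IsJoinTree (C : Type w) [L.Structure C] (J : SimpleGraph (tuples L C)) : Prop :=
  J.IsTree ∧ ∀ x : C, (J.induce {c | x ∈ Set.range c.1.2}).Connected

/-- A structure is acyclic if it has a join-tree. -/
def IsAcyclic (C : Type w) [L.Structure C] : Prop :=
  ∃ J : SimpleGraph (tuples L C), IsJoinTree L C J

/-- Every (finite, nonempty, covered) acyclic structure has equally many homomorphisms to `A` and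
to `B`. -/
def HomIndistinguishable (A : Type u) [L.Structure A] (B : Type v) [L.Structure B] : Prop :=
  ∀ (C : Type w) [L.Structure C] [Finite C] [Nonempty C],
    Covered L C → IsAcyclic L C → Nat.card (C →[L] A) = Nat.card (C →[L] B)

end Homomorphisms

/-! ### The guarded fragment of first-order logic with counting -/

section Logic

/-- Raw formulas; variables are natural numbers.  The constructor `existsGe n y R x ψ` stands for
the formula "there are at least `n` tuples `y` such that `R(x) ∧ ψ`". -/
inductive Formula (L : FirstOrder.Language.{uF, uR}) : Type uR
  | rel {k : ℕ} (R : L.Relations k) (x : Fin k → ℕ) : Formula L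
  | eq (x y : ℕ) : Formula L
  | neg (χ : Formula L) : Formula L
  | and (χ ψ : Formula L) : Formula L
  | existsGe (n : ℕ) {m : ℕ} (y : Fin m → ℕ) {k : ℕ} (R : L.Relations k) (x : Fin k → ℕ)
      (ψ : Formula L) : Formula L

variable {L : FirstOrder.Language.{uF, uR}}

/-- The free variables of a formula. -/
def Formula.free : Formula L → Set ℕ
  | .rel _ x => Set.range x
  | .eq x y => {x, y}
  | .neg χ => χ.free
  | .and χ ψ => χ.free ∪ ψ.free
  | .existsGe _ y _ x _ => Set.range x \ Set.range y

/-- The formula belongs to the guarded fragment: in each quantification, the number is positive,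
the quantified variables are distinct and occur in the guard, and the guard contains all free
variables of the formula it guards. -/
def Formula.IsGuarded : Formula L → Prop
  | .rel _ _ => True
  | .eq _ _ => True
  | .neg χ => χ.IsGuarded
  | .and χ ψ => χ.IsGuarded ∧ ψ.IsGuarded
  | .existsGe n y _ x ψ =>
    1 ≤ n ∧ Function.Injective y ∧ Set.range y ⊆ Set.range x ∧ ψ.free ⊆ Set.range x ∧ ψ.IsGuarded

/-- Satisfaction of a formula in a structure under an assignment.  The assignment
`Function.extend y a α` maps `y j` to `a j` and agrees with `α` on all other variables. -/
def Formula.Sat {A : Type u} [L.Structure A] : Formula L → (ℕ → A) → Prop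
  | .rel R x, α => Structure.RelMap R fun i => α (x i)
  | .eq x y, α => α x = α y
  | .neg χ, α => ¬ χ.Sat α
  | .and χ ψ, α => χ.Sat α ∧ ψ.Sat α
  | .existsGe n (m := m) y R x ψ, α =>
    n ≤ {a : Fin m → A | (Structure.RelMap R fun i => Function.extend y a α (x i)) ∧
      ψ.Sat (Function.extend y a α)}.ncard

variable (L)

/-- `A` and `B` satisfy the same sentences of the guarded fragment with counting. -/
def GuardedEquivalent (A : Type u) [L.Structure A] (B : Type v) [L.Structure B] : Prop :=
  ∀ φ : Formula L, φ.IsGuarded → φ.free = ∅ →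
    ((∀ α : ℕ → A, φ.Sat α) ↔ (∀ β : ℕ → B, φ.Sat β))

end Logic

/-! ### The Guarded-Game -/

section Game

variable (L : FirstOrder.Language.{uF, uR})
variable {A : Type u} [L.Structure A] {B : Type v} [L.Structure B]

/-- The configuration `(A, a), (B, b)` is distinguishing.  For `l` that is not the arity of a
relation symbol both atomic types are empty, so `l` needs no bound. -/
def DistinguishingConfig {k : ℕ} (a : Fin k → A) (b : Fin k → B) : Prop :=
  stp a a ≠ stp b b ∨
    ∃ (l : ℕ) (s : Fin l → Fin k), atp L (fun i => a (s i)) ≠ atp L (fun i => b (s i))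

/-- Duplicator has an `i`-round winning strategy on `(A, a), (B, b)`. -/
def DuplicatorStrategy : (i : ℕ) → {k : ℕ} → (Fin k → A) → (Fin k → B) → Prop
  | 0, _, a, b => ¬ DistinguishingConfig L a b
  | i + 1, _, a, b =>
    ¬ DistinguishingConfig L a b ∧
      ∀ (l : ℕ) (R : L.Relations l),
        ∃ π : {a' : Fin l → A // Structure.RelMap R a'} ≃
            {b' : Fin l → B // Structure.RelMap R b'},
          ∀ a' : {a' : Fin l → A // Structure.RelMap R a'},
            ¬ DistinguishingConfig L a'.1 (π a').1 ∧
            stp a a'.1 = stp b (π a').1 ∧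
            DuplicatorStrategy i a'.1 (π a').1

/-- Duplicator wins the Guarded-Game on `A, B`, starting from the empty configuration. -/
def DuplicatorWins (A : Type u) [L.Structure A] (B : Type v) [L.Structure B] : Prop :=
  ∀ i : ℕ, DuplicatorStrategy L i (Fin.elim0 : Fin 0 → A) (Fin.elim0 : Fin 0 → B)

end Game

end RCR

/-! All four conditions are compared with a fifth, `Bisimilar`: a relation `E` between the tuples of
`A` and of `B` such that related tuples have equal atomic types, some bijection of all tuples
respects `E`, and for each related pair `a`, `b` some such bijection also preserves the similarity
type to `a` and `b`.

Stable colors give such a relation. The multiset in a color only counts tuples that overlap `a`, but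
the global color counts agree, so subtraction also yields the disjoint ones
(`exists_equiv_of_col_succ_eq`).

A bisimulation serves the other three conditions directly. Duplicator answers with its bijections.
They carry witnesses of a guarded quantifier to witnesses (`IsBisim.card_existsGe_le`). Applied from
the root of a join-tree downwards, they transport homomorphisms injectively (`IsBisim.exists_hom`).

For the way back, a bijection in the game preserves colors by induction on the rounds. In the logic,
colors of each round are definable on the finite structures `A`, `B`. Guarded formulas count the
tuples whose similarity type contains a given set, and inversion over inclusion
(`card_fiber_eq_of_card_upper`) turns this into exact similarity types.

For homomorphisms, labelled trees describe acyclic structures, and `count` is the number of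
homomorphisms with prescribed image of the root tuple. Gluing trees at their roots multiplies
counts, and hanging a tree below a new root sums them over neighbors. The span of the count
functions is therefore closed under products and contains the indicators of the classes of tuples
with equal counts. Equality of counts is then a bisimulation, again by inversion. -/

namespace RCR

/-! ### Bijections from fiber counts, and inversion over a partial order -/

section Counting

/-- Glue arbitrary bijections between corresponding fibers. This is how equal counts become the
bijections of a bisimulation. -/
theorem exists_equiv_of_card_fiber {X : Type*} {Y : Type*} {γ : Type*} [Finite X] [Finite Y]
    (f : X → γ) (g : Y → γ)
    (h : ∀ c, Nat.card {x // f x = c} = Nat.card {y // g y = c}) :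
    ∃ σ : X ≃ Y, ∀ x, g (σ x) = f x := by
  let e := fun c => Classical.choice (Finite.card_eq.1 (h c))
  refine ⟨(Equiv.sigmaFiberEquiv f).symm.trans
    ((Equiv.sigmaCongrRight e).trans (Equiv.sigmaFiberEquiv g)), fun x => ?_⟩
  exact (e (f x) ⟨x, rfl⟩).2

theorem card_subtype_congr {X : Type*} {Y : Type*} (σ : X ≃ Y) {P : X → Prop} {Q : Y → Prop}
    (h : ∀ x, P x ↔ Q (σ x)) : Nat.card {x // P x} = Nat.card {y // Q y} :=
  Nat.card_congr (σ.subtypeEquiv h)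

theorem card_subtype_subtype {X : Type*} (P Q : X → Prop) :
    Nat.card {x : {x // P x} // Q x.1} = Nat.card {x // P x ∧ Q x} :=
  Nat.card_congr (Equiv.subtypeSubtypeEquivSubtypeInter P Q)

theorem card_eq_add_card {X : Type*} [Finite X] (P Q : X → Prop) :
    Nat.card {x // P x} = Nat.card {x // P x ∧ Q x} + Nat.card {x // P x ∧ ¬ Q x} := by
  classical
  have := Fintype.ofFinite X
  simp only [Nat.card_eq_fintype_card, Fintype.card_subtype]
  rw [← Finset.card_filter_add_card_filter_not (s := Finset.univ.filter P) Q, Finset.filter_filter,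
    Finset.filter_filter]

open Classical in
theorem card_upper_eq_add {X : Type*} {P : Type*} [PartialOrder P] [Finite X] (k : X → P)
    (V : Finset P) (hk : ∀ x, k x ∈ V) (S : P) :
    Nat.card {x // S ≤ k x} =
      Nat.card {x // k x = S} + ∑ T ∈ V.filter (S < ·), Nat.card {x // k x = T} := by
  have := Fintype.ofFinite X
  simp only [Nat.card_eq_fintype_card, Fintype.card_subtype]
  have h1 : (Finset.univ.filter fun z => S ≤ k z) =
      (Finset.univ.filter fun z => k z = S) ∪ (Finset.univ.filter fun z => S < k z) := by
    ext z
    simp only [Finset.mem_filter, Finset.mem_univ, true_and, Finset.mem_union, le_iff_eq_or_lt,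
      eq_comm]
  rw [h1, Finset.card_union_of_disjoint, Finset.card_eq_sum_card_fiberwise
    (s := Finset.univ.filter fun z => S < k z) (f := k) (t := V.filter (S < ·))]
  · congr 1
    refine Finset.sum_congr rfl fun T hT => ?_
    congr 1
    ext z
    simp only [Finset.mem_filter, Finset.mem_univ, true_and] at hT ⊢
    exact ⟨fun h => h.2, fun h => ⟨h ▸ hT.2, h⟩⟩
  · intro z hz
    simp only [Finset.coe_filter, Finset.mem_univ, true_and, Set.mem_ofPred_eq] at hz ⊢
    exact ⟨hk z, hz⟩
  · rw [Finset.disjoint_filter]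
    rintro z - h1 h2
    exact h2.ne h1.symm

/-- Inversion over a partial order: the cardinalities of the sets of points with value at least `S`
determine the cardinalities of the fibers. -/
theorem card_fiber_eq_of_card_upper {X : Type*} {Y : Type*} {P : Type*} [PartialOrder P]
    [Finite X] [Finite Y] (f : X → P) (g : Y → P) (U : P → Prop)
    (hU : ∀ S T, U S → S ≤ T → U T)
    (h : ∀ S, U S → Nat.card {x // S ≤ f x} = Nat.card {y // S ≤ g y}) (S : P) (hS : U S) :
    Nat.card {x // f x = S} = Nat.card {y // g y = S} := by
  classical
  have := Fintype.ofFinite X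
  have := Fintype.ofFinite Y
  set V : Finset P := Finset.univ.image f ∪ Finset.univ.image g with hV
  have hf : ∀ x, f x ∈ V := by simp [hV]
  have hg : ∀ y, g y ∈ V := by simp [hV]
  -- Downward induction: for an attained value `T` above `S`, fewer attained values lie above `T`,
  -- since `T` itself drops out.
  induction hn : (V.filter (S < ·)).card using Nat.strong_induction_on generalizing S with
  | _ n ih =>
  have h2 := h S hS
  have e1 := card_upper_eq_add f V hf S
  have e2 := card_upper_eq_add g V hg S
  have e3 : ∑ T ∈ V.filter (S < ·), Nat.card {z // f z = T} =
      ∑ T ∈ V.filter (S < ·), Nat.card {z // g z = T} := by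
    refine Finset.sum_congr rfl fun T hT => ?_
    have hT' := (Finset.mem_filter.1 hT).2
    refine ih _ ?_ T (hU S T hS hT'.le) rfl
    rw [← hn]
    refine Finset.card_lt_card ⟨fun Q hQ => ?_, fun hsub => ?_⟩
    · simp only [Finset.mem_filter] at hQ ⊢
      exact ⟨hQ.1, hT'.trans hQ.2⟩
    · exact lt_irrefl _ (Finset.mem_filter.1 (hsub hT)).2
  omega

end Counting

/-! ### A refinement step expressed by counts -/

section Refinement

variable (L : FirstOrder.Language.{uF, uR}) [Finite (Σ k : ℕ, L.Relations k)]
variable (A : Type u) [L.Structure A] [Finite A] (B : Type v) [L.Structure B] [Finite B]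

instance : Finite (tuples L A) := tuples_finite L A

variable {A B}

theorem mem_overlapping {a b : Tuple A} :
    b ∈ overlapping L A a ↔ b ∈ tuples L A ∧ (stp a.2 b.2).Nonempty := by
  simp [overlapping]

theorem colorCount_eq (i : ℕ) (c : Color L i) :
    colorCount L A i c = Nat.card {y : tuples L A // col L A i y = c} := by
  rw [colorCount, ← Nat.card_coe_set_eq]
  exact Nat.card_congr (Equiv.subtypeSubtypeEquivSubtypeInter _ _).symm

open Classical in
theorem count_overlapping (i : ℕ) (a : Tuple A) (S : Set (ℕ × ℕ)) (c : Color L i) :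
    ((overlapping L A a).val.map fun b => (stp a.2 b.2, col L A i b)).count (S, c) =
      Nat.card {y : tuples L A // (stp a.2 y.1.2).Nonempty ∧
        stp a.2 y.1.2 = S ∧ col L A i y = c} := by
  rw [Multiset.count_map, ← Finset.filter_val, Finset.card_val, ← Fintype.card_coe,
    ← Nat.card_eq_fintype_card]
  refine Nat.card_congr ⟨fun y => ⟨⟨y.1, ?_⟩, ?_⟩, fun y => ⟨y.1.1, ?_⟩, fun y => rfl, fun y => rfl⟩
  · exact ((mem_overlapping L).1 (Finset.mem_filter.1 y.2).1).1
  · obtain ⟨h1, h2⟩ := Finset.mem_filter.1 y.2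
    rw [mem_overlapping] at h1
    exact ⟨h1.2, (Prod.mk_inj.1 h2).1.symm, (Prod.mk_inj.1 h2).2.symm⟩
  · rw [Finset.mem_filter, mem_overlapping]
    exact ⟨⟨y.1.2, y.2.1⟩, by rw [y.2.2.1, y.2.2.2]⟩

open Classical in
theorem count_overlapping_of_nonempty (i : ℕ) (a : Tuple A) {S : Set (ℕ × ℕ)} (hS : S.Nonempty)
    (c : Color L i) :
    ((overlapping L A a).val.map fun b => (stp a.2 b.2, col L A i b)).count (S, c) =
      Nat.card {y : tuples L A // stp a.2 y.1.2 = S ∧ col L A i y = c} := by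
  rw [count_overlapping]
  refine Nat.card_congr (Equiv.subtypeEquivRight fun y => ?_)
  exact ⟨fun h => h.2, fun h => ⟨h.1 ▸ hS, h⟩⟩

open Classical in
theorem count_overlapping_of_not_nonempty (i : ℕ) (a : Tuple A) {S : Set (ℕ × ℕ)}
    (hS : ¬ S.Nonempty) (c : Color L i) :
    ((overlapping L A a).val.map fun b => (stp a.2 b.2, col L A i b)).count (S, c) = 0 := by
  rw [count_overlapping]
  have : IsEmpty {y : tuples L A // (stp a.2 y.1.2).Nonempty ∧ stp a.2 y.1.2 = S ∧
      col L A i y = c} := ⟨fun y => hS (y.2.2.1 ▸ y.2.1)⟩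
  exact Nat.card_of_isEmpty

/-- The restriction to nonempty `S` reflects that a color does not record the tuples disjoint from
`a`. -/
theorem col_succ_eq_iff {i : ℕ} {a : Tuple A} {b : Tuple B} :
    col L A (i + 1) a = col L B (i + 1) b ↔ col L A i a = col L B i b ∧
      ∀ S : Set (ℕ × ℕ), S.Nonempty → ∀ c : Color L i,
        Nat.card {y : tuples L A // stp a.2 y.1.2 = S ∧ col L A i y = c} =
        Nat.card {y : tuples L B // stp b.2 y.1.2 = S ∧ col L B i y = c} := by
  classical
  have h1 : col L A (i + 1) a = col L B (i + 1) b ↔ col L A i a = col L B i b ∧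
      ((overlapping L A a).val.map fun y => (stp a.2 y.2, col L A i y)) =
      ((overlapping L B b).val.map fun y => (stp b.2 y.2, col L B i y)) := by
    exact Prod.mk_inj
  rw [h1]
  refine and_congr_right fun _ => ?_
  rw [Multiset.ext]
  constructor
  · intro h S hS c
    rw [← count_overlapping_of_nonempty L i a hS, ← count_overlapping_of_nonempty L i b hS]
    exact h (S, c)
  · rintro h ⟨S, c⟩
    by_cases hS : S.Nonempty
    · rw [count_overlapping_of_nonempty L i a hS, count_overlapping_of_nonempty L i b hS]
      exact h S hS c
    · rw [count_overlapping_of_not_nonempty L i a hS, count_overlapping_of_not_nonempty L i b hS]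

theorem card_overlapping_color {i : ℕ} {a : Tuple A} {b : Tuple B}
    (h : col L A (i + 1) a = col L B (i + 1) b) (c : Color L i) :
    Nat.card {y : tuples L A // col L A i y = c ∧ (stp a.2 y.1.2).Nonempty} =
    Nat.card {y : tuples L B // col L B i y = c ∧ (stp b.2 y.1.2).Nonempty} := by
  have h2 := ((col_succ_eq_iff L).1 h).2
  obtain ⟨σ, hσ⟩ := exists_equiv_of_card_fiber
    (fun y : {y : tuples L A // col L A i y = c ∧ (stp a.2 y.1.2).Nonempty} => stp a.2 y.1.1.2)
    (fun y : {y : tuples L B // col L B i y = c ∧ (stp b.2 y.1.2).Nonempty} => stp b.2 y.1.1.2) (by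
      intro S
      by_cases hS : S.Nonempty
      · rw [card_subtype_subtype
          (fun y : tuples L A => col L A i y = c ∧ (stp a.2 y.1.2).Nonempty)
          (fun y : tuples L A => stp a.2 y.1.2 = S), card_subtype_subtype
          (fun y : tuples L B => col L B i y = c ∧ (stp b.2 y.1.2).Nonempty)
          (fun y : tuples L B => stp b.2 y.1.2 = S)]
        refine Eq.trans (Nat.card_congr (Equiv.subtypeEquivRight fun y => ?_))
          ((h2 S hS c).trans (Nat.card_congr (Equiv.subtypeEquivRight fun y => ?_)))
        · exact ⟨fun h => ⟨h.2, h.1.1⟩, fun h => ⟨⟨h.2, h.1 ▸ hS⟩, h.1⟩⟩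
        · exact ⟨fun h => ⟨⟨h.2, h.1 ▸ hS⟩, h.1⟩, fun h => ⟨h.2, h.1.1⟩⟩
      · have e1 : IsEmpty {x : {y : tuples L A // col L A i y = c ∧ (stp a.2 y.1.2).Nonempty} //
          stp a.2 x.1.1.2 = S} := ⟨fun y => hS (y.2 ▸ y.1.2.2)⟩
        have e2 : IsEmpty {x : {y : tuples L B // col L B i y = c ∧ (stp b.2 y.1.2).Nonempty} //
          stp b.2 x.1.1.2 = S} := ⟨fun y => hS (y.2 ▸ y.1.2.2)⟩
        rw [Nat.card_of_isEmpty, Nat.card_of_isEmpty])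
  exact Nat.card_congr σ

theorem col_eq_of_le {i j : ℕ} (hij : i ≤ j) {a : Tuple A} {b : Tuple B}
    (h : col L A j a = col L B j b) : col L A i a = col L B i b := by
  induction hij with
  | refl => exact h
  | step _ ih => exact ih ((col_succ_eq_iff L).1 h).1

variable (A B)

/-- There are finitely many pairs, each separable pair is separated in some round and stays
separated; take a bound on these rounds. -/
theorem exists_stable_round : ∃ I, ∀ (a : tuples L A) (b : tuples L B),
    col L A I a = col L B I b → ∀ i, col L A i a = col L B i b := by
  have h : ∀ p : tuples L A × tuples L B, ∃ n, col L A n p.1 = col L B n p.2 →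
      ∀ i, col L A i p.1 = col L B i p.2 := by
    intro p
    by_cases hp : ∀ i, col L A i p.1 = col L B i p.2
    · exact ⟨0, fun _ => hp⟩
    · push Not at hp
      obtain ⟨n, hn⟩ := hp
      exact ⟨n, fun h => absurd h hn⟩
  choose n hn using h
  obtain ⟨I, hI⟩ := (Set.finite_range n).bddAbove
  exact ⟨I, fun a b hab => hn (a, b) (col_eq_of_le L (hI ⟨(a, b), rfl⟩) hab)⟩

end Refinement

/-! ### Similarity types and atomic types of tuples -/

section Tuples

theorem mem_stp_iff {A : Type u} {k l : ℕ} {a : Fin k → A} {b : Fin l → A} {i : Fin k}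
    {j : Fin l} : ((i : ℕ), (j : ℕ)) ∈ stp a b ↔ a i = b j := by
  constructor
  · rintro ⟨i', j', h, h'⟩
    obtain ⟨h1, h2⟩ := Prod.mk_inj.1 h
    obtain rfl := Fin.ext h1
    obtain rfl := Fin.ext h2
    exact h'
  · exact fun h => ⟨i, j, rfl, h⟩

theorem stp_of_length_zero {A : Type u} {l : ℕ} (a : Fin 0 → A) (b : Fin l → A) :
    stp a b = ∅ := by
  ext p
  simp [stp]

/-- Each entry of `z` is tied to an entry of `a`. Equality of similarity types thereby pins down
images under the bijections used later. -/
theorem tuple_eq_of_stp {A : Type u} {k l : ℕ} {a : Fin k → A} {z : Tuple A} (hz : z.1 = l)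
    (s : Fin l → Fin k) (h : ∀ j, ((s j : ℕ), (j : ℕ)) ∈ stp a z.2) :
    z = ⟨l, fun j => a (s j)⟩ := by
  obtain ⟨l', z⟩ := z
  obtain rfl : l' = l := hz
  congr 1
  funext j
  exact (mem_stp_iff.1 (h j)).symm

variable {L : FirstOrder.Language.{uF, uR}} {A : Type u} [L.Structure A] {B : Type v}
  [L.Structure B]

theorem length_eq_of_mem_atp {S : Σ n : ℕ, L.Relations n} {k : ℕ} {a : Fin k → A}
    (h : S ∈ atp L a) : S.1 = k := by
  obtain ⟨R, rfl, -⟩ := h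
  rfl

theorem mem_atp_iff {k : ℕ} {R : L.Relations k} {a : Fin k → A} :
    (⟨k, R⟩ : Σ n : ℕ, L.Relations n) ∈ atp L a ↔ Structure.RelMap R a := by
  constructor
  · rintro ⟨R', h, h'⟩
    cases h
    exact h'
  · exact fun h => ⟨R, rfl, h⟩

theorem exists_mem_atp (y : tuples L A) : ∃ S, S ∈ atp L y.1.2 := by
  obtain ⟨R, hR⟩ := y.2
  exact ⟨_, mem_atp_iff.2 hR⟩

theorem length_eq_of_atp_eq (y : tuples L A) {l : ℕ} {b : Fin l → B}
    (h : atp L y.1.2 = atp L b) : y.1.1 = l := by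
  obtain ⟨S, hS⟩ := exists_mem_atp y
  exact (length_eq_of_mem_atp hS).symm.trans (length_eq_of_mem_atp (h ▸ hS))

variable (A) in
theorem bijective_toTuples {l : ℕ} (R : L.Relations l) : Function.Bijective
    (fun a => ⟨⟨⟨l, a.1⟩, R, a.2⟩, R, rfl, a.2⟩ : {a : Fin l → A // Structure.RelMap R a} →
      {y : tuples L A // ⟨l, R⟩ ∈ atp L y.1.2}) := by
  constructor
  · rintro ⟨a, ha⟩ ⟨b, hb⟩ h
    have h' : (⟨l, a⟩ : Tuple A) = ⟨l, b⟩ := congrArg (fun y => y.1.1) h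
    exact Subtype.ext (eq_of_heq (Sigma.mk.inj h').2)
  · rintro ⟨⟨⟨l', y⟩, hy⟩, R', h, hR⟩
    cases h
    exact ⟨⟨y, hR⟩, rfl⟩

variable (A) in
/-- The tuples in one relation, as tuples of the structure. -/
noncomputable def relEquiv {l : ℕ} (R : L.Relations l) :
    {a : Fin l → A // Structure.RelMap R a} ≃ {y : tuples L A // ⟨l, R⟩ ∈ atp L y.1.2} :=
  Equiv.ofBijective _ (bijective_toTuples A R)

theorem relEquiv_apply {l : ℕ} (R : L.Relations l) (a : {a : Fin l → A // Structure.RelMap R a}) :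
    (relEquiv A R a).1.1 = ⟨l, a.1⟩ := rfl

end Tuples

/-! ### Bisimulations between the tuples of two structures -/

section Bisimulation

variable (L : FirstOrder.Language.{uF, uR})

/-- A back-and-forth system between the tuples of `A` and `B`. -/
structure IsBisim {A : Type u} [L.Structure A] {B : Type v} [L.Structure B]
    (E : tuples L A → tuples L B → Prop) : Prop where
  atp_eq : ∀ a b, E a b → atp L a.1.2 = atp L b.1.2
  forth : ∀ a b, E a b → ∃ σ : tuples L A ≃ tuples L B,
    ∀ y, stp a.1.2 y.1.2 = stp b.1.2 (σ y).1.2 ∧ E y (σ y)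
  total : ∃ σ : tuples L A ≃ tuples L B, ∀ y, E y (σ y)

/-- There is a back-and-forth system between `A` and `B`. -/
def Bisimilar (A : Type u) [L.Structure A] (B : Type v) [L.Structure B] : Prop :=
  ∃ E : tuples L A → tuples L B → Prop, IsBisim L E

/-- The configuration `a, b` is compatible with the relation `E`. -/
def Linked {A : Type u} [L.Structure A] {B : Type v} [L.Structure B]
    (E : tuples L A → tuples L B → Prop) {k : ℕ} (a : Fin k → A) (b : Fin k → B) : Prop :=
  stp a a = stp b b ∧ ∃ σ : tuples L A ≃ tuples L B,
    ∀ y, stp a y.1.2 = stp b (σ y).1.2 ∧ E y (σ y)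

variable {L}
variable {A : Type u} [L.Structure A] {B : Type v} [L.Structure B]
variable {E : tuples L A → tuples L B → Prop}

theorem IsBisim.flip (h : IsBisim L E) : IsBisim L (flip E) where
  atp_eq b a hab := (h.atp_eq a b hab).symm
  forth b a hab := by
    obtain ⟨σ, hσ⟩ := h.forth a b hab
    refine ⟨σ.symm, fun y => ?_⟩
    have := hσ (σ.symm y)
    rw [σ.apply_symm_apply] at this
    exact ⟨this.1.symm, this.2⟩
  total := by
    obtain ⟨σ, hσ⟩ := h.total
    refine ⟨σ.symm, fun y => ?_⟩
    have := hσ (σ.symm y)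
    rwa [σ.apply_symm_apply] at this

theorem Bisimilar.symm (h : Bisimilar L A B) : Bisimilar L B A :=
  let ⟨_, hE⟩ := h
  ⟨_, hE.flip⟩

theorem Linked.flip {k : ℕ} {a : Fin k → A} {b : Fin k → B} (h : Linked L E a b) :
    Linked L (flip E) b a := by
  obtain ⟨h1, σ, hσ⟩ := h
  refine ⟨h1.symm, σ.symm, fun y => ?_⟩
  have := hσ (σ.symm y)
  rw [σ.apply_symm_apply] at this
  exact ⟨this.1.symm, this.2⟩

theorem IsBisim.length_eq (h : IsBisim L E) {a : tuples L A} {b : tuples L B} (hab : E a b) :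
    b.1.1 = a.1.1 :=
  (length_eq_of_atp_eq a (h.atp_eq a b hab)).symm

/-- The bijection for `a`, `b` must send `a` to `b`, because the diagonal ties the image of `a` to
`b` in every position. So `IsBisim` need not demand this equality. -/
theorem IsBisim.stp_eq (h : IsBisim L E) {a : tuples L A} {b : tuples L B} (hab : E a b) :
    stp a.1.2 a.1.2 = stp b.1.2 b.1.2 := by
  obtain ⟨σ, hσ⟩ := h.forth a b hab
  have hl := h.length_eq hab
  have hl' := h.length_eq (hσ a).2
  have hb : (σ a).1 = b.1 := by
    rw [tuple_eq_of_stp (a := b.1.2) (hl'.trans hl.symm) id]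
    · rfl
    · intro j
      rw [← (hσ a).1]
      exact mem_stp_iff (i := Fin.cast hl j) (j := Fin.cast hl j).2 rfl
  rw [(hσ a).1, hb]

theorem IsBisim.linked (h : IsBisim L E) {a : tuples L A} {b : tuples L B} (hab : E a b) {l : ℕ}
    {a' : Fin l → A} {b' : Fin l → B} (ha : a.1 = ⟨l, a'⟩) (hb : b.1 = ⟨l, b'⟩) :
    Linked L E a' b' := by
  have h1 := h.stp_eq hab
  have h2 := h.forth a b hab
  rw [ha, hb] at h1 h2
  exact ⟨h1, h2⟩

theorem IsBisim.linked_of_length_zero (h : IsBisim L E) (a : Fin 0 → A) (b : Fin 0 → B) :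
    Linked L E a b := by
  refine ⟨by rw [stp_of_length_zero, stp_of_length_zero], ?_⟩
  obtain ⟨σ, hσ⟩ := h.total
  exact ⟨σ, fun y => ⟨by rw [stp_of_length_zero, stp_of_length_zero], hσ y⟩⟩

/-- The selected entries of `a` form a tuple of the structure; its image under `σ` is tied to `b`
through `s`, so it is `b ∘ s`, with the same atomic type. -/
theorem IsBisim.relMap_of_linked (h : IsBisim L E) {k : ℕ} {a : Fin k → A} {b : Fin k → B}
    (hab : Linked L E a b) {l : ℕ} (s : Fin l → Fin k) {R : L.Relations l}
    (hR : Structure.RelMap R fun j => a (s j)) : Structure.RelMap R fun j => b (s j) := by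
  obtain ⟨-, σ, hσ⟩ := hab
  let y : tuples L A := ⟨⟨l, fun j => a (s j)⟩, R, hR⟩
  have h1 := (hσ y).1
  have h2 := h.atp_eq _ _ (hσ y).2
  have h3 : (σ y).1 = ⟨l, fun j => b (s j)⟩ := by
    refine tuple_eq_of_stp (h.length_eq (hσ y).2) s fun j => ?_
    rw [← h1]
    exact mem_stp_iff.2 rfl
  rw [h3] at h2
  exact mem_atp_iff.1 (h2 ▸ mem_atp_iff.2 hR)

theorem IsBisim.not_distinguishing (h : IsBisim L E) {k : ℕ} {a : Fin k → A} {b : Fin k → B}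
    (hab : Linked L E a b) : ¬ DistinguishingConfig L a b := by
  rintro (h1 | ⟨l, s, h1⟩)
  · exact h1 hab.1
  · refine h1 (Set.ext fun S => ⟨?_, ?_⟩)
    · rintro ⟨R, rfl, hR⟩
      exact ⟨R, rfl, h.relMap_of_linked hab s hR⟩
    · rintro ⟨R, rfl, hR⟩
      exact ⟨R, rfl, h.flip.relMap_of_linked hab.flip s hR⟩

end Bisimulation

/-! ### Color refinement and bisimulation -/

section Refinement

variable {L : FirstOrder.Language.{uF, uR}} [Finite (Σ k : ℕ, L.Relations k)]
variable {A : Type u} [L.Structure A] [Finite A] {B : Type v} [L.Structure B] [Finite B]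

theorem not_distinguishes_iff :
    ¬ Distinguishes L A B ↔ ∀ i (c : Color L i), colorCount L A i c = colorCount L B i c := by
  constructor
  · intro h i c
    by_contra hc
    refine h ⟨i, c, ?_, hc⟩
    by_contra hn
    simp only [cols, Set.mem_union, Set.mem_image, not_or, not_exists, not_and] at hn
    refine hc ?_
    have e1 : {a | a ∈ tuples L A ∧ col L A i a = c} = ∅ :=
      Set.eq_empty_of_forall_notMem fun a ha => hn.1 a ha.1 ha.2
    have e2 : {a | a ∈ tuples L B ∧ col L B i a = c} = ∅ :=
      Set.eq_empty_of_forall_notMem fun a ha => hn.2 a ha.1 ha.2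
    rw [colorCount, colorCount, e1, e2, Set.ncard_empty, Set.ncard_empty]
  · rintro h ⟨i, c, -, hc⟩
    exact hc (h i c)

theorem Bisimilar.not_distinguishes (h : Bisimilar L A B) : ¬ Distinguishes L A B := by
  obtain ⟨E, hE⟩ := h
  have key : ∀ i a b, E a b → col L A i a = col L B i b := by
    intro i
    induction i with
    | zero =>
      intro a b hab
      exact Prod.ext (hE.atp_eq a b hab) (hE.stp_eq hab)
    | succ i ih =>
      intro a b hab
      refine (col_succ_eq_iff L).2 ⟨ih a b hab, fun S _ c => ?_⟩
      obtain ⟨σ, hσ⟩ := hE.forth a b hab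
      refine card_subtype_congr σ fun y => ?_
      rw [(hσ y).1, ih y (σ y) (hσ y).2]
  refine not_distinguishes_iff.2 fun i c => ?_
  obtain ⟨σ, hσ⟩ := hE.total
  rw [colorCount_eq, colorCount_eq]
  exact card_subtype_congr σ fun y => by rw [key i y (σ y) (hσ y)]

theorem exists_equiv_of_col_succ_eq {i : ℕ} {a : Tuple A} {b : Tuple B}
    (hc : ∀ c : Color L i, colorCount L A i c = colorCount L B i c)
    (hab : col L A (i + 1) a = col L B (i + 1) b) : ∃ σ : tuples L A ≃ tuples L B,
      ∀ y, stp a.2 y.1.2 = stp b.2 (σ y).1.2 ∧ col L A i y = col L B i (σ y) := by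
  obtain ⟨σ, hσ⟩ := exists_equiv_of_card_fiber
    (fun y : tuples L A => (stp a.2 y.1.2, col L A i y))
    (fun y : tuples L B => (stp b.2 y.1.2, col L B i y)) (by
      rintro ⟨S, c⟩
      simp only [Prod.mk.injEq]
      -- For empty `S` the count is the size of the color class minus the number of its members
      -- overlapping `a`.
      obtain rfl | hS := S.eq_empty_or_nonempty
      · have e := hc c
        have e1 := card_overlapping_color L hab c
        rw [colorCount_eq, colorCount_eq,
          card_eq_add_card _ (fun y : tuples L A => (stp a.2 y.1.2).Nonempty),
          card_eq_add_card _ (fun y : tuples L B => (stp b.2 y.1.2).Nonempty), e1] at e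
        have e2 := Nat.add_left_cancel e
        simp only [Set.not_nonempty_iff_eq_empty] at e2
        simpa only [and_comm] using e2
      · exact ((col_succ_eq_iff L).1 hab).2 S hS c)
  refine ⟨σ, fun y => ?_⟩
  have := Prod.mk_inj.1 (hσ y)
  exact ⟨this.1.symm, this.2.symm⟩

theorem bisimilar_of_not_distinguishes (h : ¬ Distinguishes L A B) : Bisimilar L A B := by
  rw [not_distinguishes_iff] at h
  obtain ⟨I, hI⟩ := exists_stable_round L A B
  refine ⟨fun a b => ∀ i, col L A i a = col L B i b, ?_, ?_, ?_⟩
  · intro a b hab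
    exact (Prod.mk_inj.1 (hab 0)).1
  · intro a b hab
    -- Equal colors in round `I + 1` give a bijection preserving round `I`, and by stability every
    -- round.
    obtain ⟨σ, hσ⟩ := exists_equiv_of_col_succ_eq (h I) (hab (I + 1))
    exact ⟨σ, fun y => ⟨(hσ y).1, hI _ _ (hσ y).2⟩⟩
  · obtain ⟨σ, hσ⟩ := exists_equiv_of_card_fiber (fun y : tuples L A => col L A I y)
      (fun y : tuples L B => col L B I y) (fun c => by
        have := h I c
        rwa [colorCount_eq, colorCount_eq] at this)
    exact ⟨σ, fun y => hI _ _ (hσ y).symm⟩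

end Refinement

/-! ### The Guarded-Game -/

section Game

variable {L : FirstOrder.Language.{uF, uR}}
variable {A : Type u} [L.Structure A] {B : Type v} [L.Structure B]

/-- Duplicator plays the restriction to `R` of the bijection that links the configuration. The new
tuples are `E`-related, hence linked again. -/
theorem IsBisim.duplicatorStrategy {E : tuples L A → tuples L B → Prop} (h : IsBisim L E)
    (i : ℕ) {k : ℕ} {a : Fin k → A} {b : Fin k → B} (hab : Linked L E a b) :
    DuplicatorStrategy L i a b := by
  induction i generalizing k with
  | zero => exact h.not_distinguishing hab
  | succ i ih =>
    refine ⟨h.not_distinguishing hab, fun l R => ?_⟩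
    obtain ⟨-, σ, hσ⟩ := hab
    have hatp : ∀ y : tuples L A, ⟨l, R⟩ ∈ atp L y.1.2 ↔ ⟨l, R⟩ ∈ atp L (σ y).1.2 := fun y => by
      rw [h.atp_eq _ _ (hσ y).2]
    refine ⟨(relEquiv A R).trans ((σ.subtypeEquiv hatp).trans (relEquiv B R).symm), fun a' => ?_⟩
    set b' := (relEquiv A R).trans ((σ.subtypeEquiv hatp).trans (relEquiv B R).symm) a' with hb'
    have h1 : relEquiv B R b' = σ.subtypeEquiv hatp (relEquiv A R a') := by simp [hb']
    have h2 : (σ (relEquiv A R a').1).1 = ⟨l, b'.1⟩ := by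
      rw [← relEquiv_apply, h1]
      rfl
    have h3 := hσ (relEquiv A R a').1
    have h4 : Linked L E a'.1 b'.1 := h.linked h3.2 rfl h2
    refine ⟨h.not_distinguishing h4, ?_, ih h4⟩
    have h5 := h3.1
    rw [h2] at h5
    exact h5

theorem Bisimilar.duplicatorWins (h : Bisimilar L A B) : DuplicatorWins L A B := by
  obtain ⟨E, hE⟩ := h
  exact fun i => hE.duplicatorStrategy i (hE.linked_of_length_zero _ _)

theorem duplicatorStrategy_of_succ {i : ℕ} {k : ℕ} {a : Fin k → A} {b : Fin k → B}
    (h : DuplicatorStrategy L (i + 1) a b) : DuplicatorStrategy L i a b := by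
  induction i generalizing k with
  | zero => exact h.1
  | succ i ih =>
    refine ⟨h.1, fun l R => ?_⟩
    obtain ⟨π, hπ⟩ := h.2 l R
    exact ⟨π, fun a' => ⟨(hπ a').1, (hπ a').2.1, ih (hπ a').2.2⟩⟩

/-- The atomic type recorded in a color. -/
def colorAtp : (i : ℕ) → Color L i → Set (Σ n : ℕ, L.Relations n)
  | 0, c => c.1
  | i + 1, c => colorAtp i c.1

variable [Finite (Σ k : ℕ, L.Relations k)] [Finite A] [Finite B]

theorem colorAtp_col (i : ℕ) (a : Tuple A) : colorAtp i (col L A i a) = atp L a.2 := by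
  induction i with
  | zero => rfl
  | succ i ih => exact ih

theorem isEmpty_col_of_colorAtp_eq_empty {i : ℕ} {c : Color L i} (hc : colorAtp i c = ∅)
    (P : tuples L A → Prop) : IsEmpty {y : tuples L A // P y ∧ col L A i y = c} := by
  refine ⟨fun y => ?_⟩
  obtain ⟨T, hT⟩ := exists_mem_atp y.1
  rw [← colorAtp_col i, y.2.2, hc] at hT
  exact hT

/-- A color determines the atomic type, so a color class lies inside one relation. A game round or a
guarded quantifier sees just one relation. -/
theorem card_eq_card_rel {i l : ℕ} {c : Color L i} {R : L.Relations l} (hc : ⟨l, R⟩ ∈ colorAtp i c)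
    (P : Tuple A → Prop) :
    Nat.card {y : tuples L A // P y ∧ col L A i y = c} =
      Nat.card {a : {a : Fin l → A // Structure.RelMap R a} //
        P ⟨l, a⟩ ∧ col L A i ⟨l, a⟩ = c} := by
  have h1 : Nat.card {a : {a : Fin l → A // Structure.RelMap R a} //
      P ⟨l, a⟩ ∧ col L A i ⟨l, a⟩ = c} =
      Nat.card {y : {y : tuples L A // ⟨l, R⟩ ∈ atp L y.1.2} // P y.1 ∧ col L A i y.1 = c} :=
    card_subtype_congr (relEquiv A R) fun a => by rw [relEquiv_apply]
  rw [h1, card_subtype_subtype (fun y : tuples L A => ⟨l, R⟩ ∈ atp L y.1.2)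
    (fun y : tuples L A => P y ∧ col L A i y = c)]
  refine Nat.card_congr (Equiv.subtypeEquivRight fun y => ⟨fun h => ⟨?_, h⟩, fun h => h.2⟩)
  rwa [← colorAtp_col i, h.2]

/-- Let Spoiler pick a relation in the atomic type of `c`: Duplicator's bijection preserves
similarity types and, by `ih`, colors. For the empty configuration and `S = ∅` this compares global
color counts. -/
theorem card_stp_col_eq_of_strategy {i : ℕ} {k : ℕ} {a : Fin k → A} {b : Fin k → B}
    (ih : ∀ {k : ℕ} {a : Fin k → A} {b : Fin k → B}, DuplicatorStrategy L i a b →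
      col L A i ⟨k, a⟩ = col L B i ⟨k, b⟩)
    (h : DuplicatorStrategy L (i + 1) a b) (S : Set (ℕ × ℕ)) (c : Color L i) :
    Nat.card {y : tuples L A // stp a y.1.2 = S ∧ col L A i y = c} =
      Nat.card {y : tuples L B // stp b y.1.2 = S ∧ col L B i y = c} := by
  obtain hc | ⟨⟨l, R⟩, hc⟩ := (colorAtp i c).eq_empty_or_nonempty
  · have e1 := isEmpty_col_of_colorAtp_eq_empty (A := A) hc (fun y => stp a y.1.2 = S)
    have e2 := isEmpty_col_of_colorAtp_eq_empty (A := B) hc (fun y => stp b y.1.2 = S)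
    rw [Nat.card_of_isEmpty, Nat.card_of_isEmpty]
  · rw [card_eq_card_rel hc (fun y => stp a y.2 = S), card_eq_card_rel hc (fun y => stp b y.2 = S)]
    obtain ⟨π, hπ⟩ := h.2 l R
    refine card_subtype_congr π fun a' => ?_
    rw [(hπ a').2.1, ih (hπ a').2.2]

theorem col_eq_of_strategy (i : ℕ) {k : ℕ} {a : Fin k → A} {b : Fin k → B}
    (h : DuplicatorStrategy L i a b) : col L A i ⟨k, a⟩ = col L B i ⟨k, b⟩ := by
  induction i generalizing k with
  | zero =>
    refine Prod.ext ?_ ?_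
    · by_contra hn
      exact h (Or.inr ⟨k, id, hn⟩)
    · by_contra hn
      exact h (Or.inl hn)
  | succ i ih =>
    exact (col_succ_eq_iff L).2 ⟨ih (duplicatorStrategy_of_succ h),
      fun S _ c => card_stp_col_eq_of_strategy ih h S c⟩

theorem DuplicatorWins.not_distinguishes (h : DuplicatorWins L A B) : ¬ Distinguishes L A B := by
  refine not_distinguishes_iff.2 fun i c => ?_
  have := card_stp_col_eq_of_strategy (col_eq_of_strategy i) (h (i + 1)) ∅ c
  rw [colorCount_eq, colorCount_eq]
  simpa only [stp_of_length_zero, true_and] using this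

end Game

/-! ### Bisimulations preserve guarded formulas -/

section BisimulationLogic

variable {L : FirstOrder.Language.{uF, uR}}
variable {A : Type u} [L.Structure A] {B : Type v} [L.Structure B]
variable {E : tuples L A → tuples L B → Prop}

/-- The image of a guard tuple repeats entries where the tuple does, and agrees with `β` at the
unquantified positions, which are tied to `z`. So it comes from an assignment to `y` alone. -/
theorem IsBisim.exists_extend (h : IsBisim L E) {k : ℕ} {z : Fin k → ℕ} {α : ℕ → A} {β : ℕ → B}
    {σ : tuples L A ≃ tuples L B}
    (hσ : ∀ y, stp (fun i => α (z i)) y.1.2 = stp (fun i => β (z i)) (σ y).1.2 ∧ E y (σ y))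
    {m : ℕ} {y : Fin m → ℕ} (hy : Function.Injective y) {l : ℕ} {R : L.Relations l}
    {x : Fin l → ℕ} (hyx : Set.range y ⊆ Set.range x)
    (hxz : Set.range x \ Set.range y ⊆ Set.range z) {a : Fin m → A}
    (ha : Structure.RelMap R fun i => Function.extend y a α (x i)) :
    ∃ b : Fin m → B, (σ ⟨⟨l, fun i => Function.extend y a α (x i)⟩, R, ha⟩).1 =
      ⟨l, fun i => Function.extend y b β (x i)⟩ := by
  set t : tuples L A := ⟨⟨l, fun i => Function.extend y a α (x i)⟩, R, ha⟩ with ht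
  have h1 := (hσ t).1
  have h2 := h.stp_eq (hσ t).2
  have h3 : (σ t).1.1 = l := h.length_eq (hσ t).2
  obtain ⟨u, hu⟩ : ∃ u : Fin l → B, (σ t).1 = ⟨l, u⟩ := by
    generalize (σ t).1 = q at h3
    obtain ⟨l', q⟩ := q
    obtain rfl : l' = l := h3
    exact ⟨q, rfl⟩
  rw [hu] at h1 h2
  choose p hp using fun j => hyx ⟨j, rfl⟩
  refine ⟨fun j => u (p j), ?_⟩
  rw [hu]
  congr 1
  funext i
  by_cases hi : ∃ j, y j = x i
  · obtain ⟨j, hj⟩ := hi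
    rw [← hj, hy.extend_apply]
    refine (mem_stp_iff (i := i) (j := p j)).1 ?_
    rw [← h2]
    refine mem_stp_iff.2 ?_
    change Function.extend y a α (x i) = Function.extend y a α (x (p j))
    rw [hp j, hj]
  · rw [Function.extend_apply' _ _ _ hi]
    obtain ⟨q, hq⟩ := hxz ⟨⟨i, rfl⟩, hi⟩
    rw [← hq]
    refine ((mem_stp_iff (i := q) (j := i) (a := fun i => β (z i)) (b := u)).1 ?_).symm
    rw [← h1]
    refine mem_stp_iff.2 ?_
    change α (z q) = Function.extend y a α (x i)
    rw [Function.extend_apply' _ _ _ hi, hq]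

/-- `σ` maps witnesses to witnesses, injectively because every quantified variable occurs in the
guard. The reverse inequality comes from `flip E`. -/
theorem IsBisim.card_existsGe_le [Finite B] (h : IsBisim L E) {k : ℕ} {z : Fin k → ℕ} {α : ℕ → A}
    {β : ℕ → B} (hab : Linked L E (fun i => α (z i)) (fun i => β (z i)))
    {m : ℕ} {y : Fin m → ℕ} (hy : Function.Injective y) {l : ℕ} {R : L.Relations l}
    {x : Fin l → ℕ} (hyx : Set.range y ⊆ Set.range x)
    (hxz : Set.range x \ Set.range y ⊆ Set.range z) {ψ : Formula L}
    (hψ : ∀ {α : ℕ → A} {β : ℕ → B}, Linked L E (fun i => α (x i)) (fun i => β (x i)) →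
      ψ.Sat α → ψ.Sat β) :
    {a : Fin m → A | (Structure.RelMap R fun i => Function.extend y a α (x i)) ∧
      ψ.Sat (Function.extend y a α)}.ncard ≤
    {b : Fin m → B | (Structure.RelMap R fun i => Function.extend y b β (x i)) ∧
      ψ.Sat (Function.extend y b β)}.ncard := by
  obtain ⟨-, σ, hσ⟩ := hab
  have key : ∀ a : {a : Fin m → A | (Structure.RelMap R fun i => Function.extend y a α (x i)) ∧
      ψ.Sat (Function.extend y a α)}, ∃ b : {b : Fin m → B |
      (Structure.RelMap R fun i => Function.extend y b β (x i)) ∧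
      ψ.Sat (Function.extend y b β)}, (σ ⟨⟨l, fun i => Function.extend y a.1 α (x i)⟩, R, a.2.1⟩).1 =
      ⟨l, fun i => Function.extend y b.1 β (x i)⟩ := by
    rintro ⟨a, ha, ha'⟩
    obtain ⟨b, hb⟩ := h.exists_extend hσ hy hyx hxz ha
    have h2 := h.atp_eq _ _ (hσ ⟨⟨l, fun i => Function.extend y a α (x i)⟩, R, ha⟩).2
    rw [hb] at h2
    refine ⟨⟨b, mem_atp_iff.1 (h2 ▸ mem_atp_iff.2 ha), hψ (h.linked (hσ _).2 rfl hb) ha'⟩, hb⟩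
  choose f hf using key
  rw [← Nat.card_coe_set_eq, ← Nat.card_coe_set_eq]
  refine Nat.card_le_card_of_injective f fun a a' haa => ?_
  have h1 := hf a
  rw [haa, ← hf a'] at h1
  have h2 := congrArg Subtype.val (σ.injective (Subtype.ext h1))
  have h3 := eq_of_heq (Sigma.mk.inj h2).2
  refine Subtype.ext (funext fun j => ?_)
  obtain ⟨i, hi⟩ := hyx ⟨j, rfl⟩
  have h4 := congrFun h3 i
  simpa only [hi, hy.extend_apply] using h4

theorem IsBisim.sat_iff [Finite A] [Finite B] (h : IsBisim L E) (φ : Formula L)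
    (hφ : φ.IsGuarded) {k : ℕ} {z : Fin k → ℕ} (hz : φ.free ⊆ Set.range z) {α : ℕ → A}
    {β : ℕ → B} (hab : Linked L E (fun i => α (z i)) (fun i => β (z i))) :
    φ.Sat α ↔ φ.Sat β := by
  induction φ generalizing k z α β with
  | rel R x =>
    choose s hs using fun j => hz ⟨j, rfl⟩
    have h1 := h.relMap_of_linked hab s (R := R)
    have h2 := h.flip.relMap_of_linked hab.flip s (R := R)
    simp only [hs] at h1 h2
    exact ⟨h1, h2⟩
  | eq x y =>
    obtain ⟨i, rfl⟩ := hz (Set.mem_insert _ _)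
    obtain ⟨j, rfl⟩ := hz (Set.mem_insert_of_mem _ rfl)
    have h1 := mem_stp_iff (a := fun i => α (z i)) (b := fun i => α (z i)) (i := i) (j := j)
    rw [hab.1, mem_stp_iff] at h1
    exact h1.symm
  | neg χ ih => exact not_congr (ih hφ hz hab)
  | and χ ψ ih1 ih2 =>
    exact and_congr (ih1 hφ.1 (Set.subset_union_left.trans hz) hab)
      (ih2 hφ.2 (Set.subset_union_right.trans hz) hab)
  | existsGe n y R x ψ ih =>
    obtain ⟨-, hy, hyx, hψx, hψ⟩ := hφ
    have h1 := h.card_existsGe_le hab hy (R := R) hyx hz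
      (fun {α β} hl => (ih hψ hψx hl).1)
    have h2 := h.flip.card_existsGe_le hab.flip hy (R := R) hyx hz
      (fun {β α} hl => (ih hψ hψx hl.flip).2)
    exact ⟨fun hn => hn.trans h1, fun hn => hn.trans h2⟩

theorem Bisimilar.guardedEquivalent [Finite A] [Nonempty A] [Finite B] [Nonempty B]
    (h : Bisimilar L A B) : GuardedEquivalent L A B := by
  obtain ⟨E, hE⟩ := h
  intro φ hφ hfree
  have key : ∀ (α : ℕ → A) (β : ℕ → B), φ.Sat α ↔ φ.Sat β := fun α β =>
    hE.sat_iff φ hφ (z := (Fin.elim0 : Fin 0 → ℕ)) (by simp [hfree])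
      (hE.linked_of_length_zero _ _)
  exact ⟨fun h β => (key (fun _ => Classical.arbitrary A) β).1 (h _),
    fun h α => (key α (fun _ => Classical.arbitrary B)).2 (h _)⟩

end BisimulationLogic

/-! ### Definability over two finite structures -/

section Definability

variable {L : FirstOrder.Language.{uF, uR}}

/-- Two assignments satisfy the same guarded formulas with free variables in `V`. -/
def GuardedAgree (L : FirstOrder.Language.{uF, uR}) {A : Type u} [L.Structure A] {B : Type v}
    [L.Structure B] (V : Set ℕ) (α : ℕ → A) (β : ℕ → B) : Prop :=
  ∀ φ : Formula L, φ.IsGuarded → φ.free ⊆ V → (φ.Sat α ↔ φ.Sat β)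

/-- `Formula.free` reads only the guard of a quantification, so this relies on the guard containing
the free variables of `ψ`. -/
theorem Formula.sat_congr {A : Type u} [L.Structure A] (φ : Formula L) (hφ : φ.IsGuarded)
    {α β : ℕ → A} (h : ∀ i ∈ φ.free, α i = β i) : φ.Sat α ↔ φ.Sat β := by
  induction φ generalizing α β with
  | rel R x =>
    have : (fun i => α (x i)) = fun i => β (x i) := funext fun i => h _ ⟨i, rfl⟩
    simp only [Formula.Sat, this]
  | eq x y =>
    simp only [Formula.Sat, h x (Set.mem_insert _ _), h y (Set.mem_insert_of_mem _ rfl)]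
  | neg χ ih => exact not_congr (ih hφ h)
  | and χ ψ ih1 ih2 =>
    exact and_congr (ih1 hφ.1 fun i hi => h i (Or.inl hi)) (ih2 hφ.2 fun i hi => h i (Or.inr hi))
  | existsGe n y R x ψ ih =>
    obtain ⟨-, hy, hyx, hψx, hψ⟩ := hφ
    have key : ∀ a, ∀ i ∈ Set.range x, Function.extend y a α i = Function.extend y a β i := by
      intro a i hi
      by_cases hiy : ∃ j, y j = i
      · obtain ⟨j, rfl⟩ := hiy
        rw [hy.extend_apply, hy.extend_apply]
      · rw [Function.extend_apply' _ _ _ hiy, Function.extend_apply' _ _ _ hiy]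
        exact h i ⟨hi, hiy⟩
    have h1 : ∀ a, (fun i => Function.extend y a α (x i)) =
        fun i => Function.extend y a β (x i) := fun a => funext fun i => key a _ ⟨i, rfl⟩
    have h2 : ∀ a, ψ.Sat (Function.extend y a α) ↔ ψ.Sat (Function.extend y a β) :=
      fun a => ih hψ fun i hi => key a i (hψx hi)
    simp only [Formula.Sat, h1, h2]

variable {A : Type u} [L.Structure A] {B : Type v} [L.Structure B]

/-- Satisfaction under an assignment into one of two structures. -/
def Formula.SatOn (φ : Formula L) : (ℕ → A) ⊕ (ℕ → B) → Prop :=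
  Sum.elim φ.Sat φ.Sat

theorem Formula.satOn_neg (φ : Formula L) (s : (ℕ → A) ⊕ (ℕ → B)) :
    (Formula.neg φ).SatOn s ↔ ¬ φ.SatOn s := by
  cases s <;> rfl

theorem Formula.satOn_and (φ ψ : Formula L) (s : (ℕ → A) ⊕ (ℕ → B)) :
    (Formula.and φ ψ).SatOn s ↔ φ.SatOn s ∧ ψ.SatOn s := by
  cases s <;> rfl

theorem exists_forall_formula {V : Set ℕ} (hV : V.Nonempty) {ι : Type*} [Finite ι]
    (φ : ι → Formula L) (hφ : ∀ i, (φ i).IsGuarded ∧ (φ i).free ⊆ V) :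
    ∃ χ : Formula L, (χ.IsGuarded ∧ χ.free ⊆ V) ∧
      ∀ s : (ℕ → A) ⊕ (ℕ → B), χ.SatOn s ↔ ∀ i, (φ i).SatOn s := by
  classical
  have := Fintype.ofFinite ι
  suffices h : ∀ T : Finset ι, ∃ χ : Formula L, (χ.IsGuarded ∧ χ.free ⊆ V) ∧
      ∀ s : (ℕ → A) ⊕ (ℕ → B), χ.SatOn s ↔ ∀ i ∈ T, (φ i).SatOn s by
    simpa using h Finset.univ
  intro T
  induction T using Finset.induction_on with
  | empty =>
    obtain ⟨x, hx⟩ := hV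
    -- The empty conjunction needs a variable from `V`.
    refine ⟨.eq x x, ⟨trivial, by simp [Formula.free, hx]⟩, fun s => ?_⟩
    cases s <;> simp [Formula.SatOn, Formula.Sat]
  | insert i T _ ih =>
    obtain ⟨χ, hχ, h⟩ := ih
    refine ⟨.and (φ i) χ, ⟨⟨(hφ i).1, hχ.1⟩, Set.union_subset (hφ i).2 hχ.2⟩, fun s => ?_⟩
    rw [Formula.satOn_and, h, Finset.forall_mem_insert]

theorem exists_exists_formula {V : Set ℕ} (hV : V.Nonempty) {ι : Type*} [Finite ι]
    (φ : ι → Formula L) (hφ : ∀ i, (φ i).IsGuarded ∧ (φ i).free ⊆ V) :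
    ∃ χ : Formula L, (χ.IsGuarded ∧ χ.free ⊆ V) ∧
      ∀ s : (ℕ → A) ⊕ (ℕ → B), χ.SatOn s ↔ ∃ i, (φ i).SatOn s := by
  obtain ⟨χ, hχ, h⟩ := exists_forall_formula (A := A) (B := B) hV (fun i => .neg (φ i)) hφ
  refine ⟨.neg χ, hχ, fun s => ?_⟩
  simp only [Formula.satOn_neg, h, not_forall, not_not]

/-- Only finitely many assignments differ on `V`. A formula separates each one with `P` from each
one without; take the disjunction, over those with `P`, of the conjunctions of separating formulas.
-/
theorem exists_formula_of_invariant [Finite A] [Nonempty A] [Finite B] [Nonempty B] {V : Set ℕ}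
    (hV : V.Nonempty) (hfin : V.Finite) (P : (ℕ → A) ⊕ (ℕ → B) → Prop)
    (hP : ∀ s t, (∀ φ : Formula L, φ.IsGuarded → φ.free ⊆ V → (φ.SatOn s ↔ φ.SatOn t)) →
      P s → P t) :
    ∃ χ : Formula L, (χ.IsGuarded ∧ χ.free ⊆ V) ∧
      ∀ s : (ℕ → A) ⊕ (ℕ → B), χ.SatOn s ↔ P s := by
  classical
  have := hfin.to_subtype
  let D := (V → A) ⊕ (V → B)
  let sec : D → (ℕ → A) ⊕ (ℕ → B) := Sum.map
    (fun d i => if h : i ∈ V then d ⟨i, h⟩ else Classical.arbitrary A)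
    (fun d i => if h : i ∈ V then d ⟨i, h⟩ else Classical.arbitrary B)
  have hsec : ∀ s : (ℕ → A) ⊕ (ℕ → B), ∃ d, ∀ φ : Formula L, φ.IsGuarded → φ.free ⊆ V →
      (φ.SatOn s ↔ φ.SatOn (sec d)) := by
    rintro (α | β)
    · refine ⟨Sum.inl fun i => α i, fun φ hφ hf => φ.sat_congr hφ fun i hi => ?_⟩
      simp [hf hi]
    · refine ⟨Sum.inr fun i => β i, fun φ hφ hf => φ.sat_congr hφ fun i hi => ?_⟩
      simp [hf hi]
  have hsep : ∀ (d : {d : D // P (sec d)}) (e : {e : D // ¬ P (sec e)}), ∃ χ : Formula L,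
      (χ.IsGuarded ∧ χ.free ⊆ V) ∧ χ.SatOn (sec d) ∧ ¬ χ.SatOn (sec e) := by
    intro d e
    by_contra! hn
    refine e.2 (hP _ _ (fun φ hφ hf => ⟨fun h => hn φ ⟨hφ, hf⟩ h, fun h => ?_⟩) d.2)
    by_contra hd
    exact (Formula.satOn_neg φ _).1
      (hn (.neg φ) ⟨hφ, hf⟩ ((Formula.satOn_neg φ _).2 hd)) h
  choose χ hχ h1 h2 using hsep
  choose χ' hχ' h' using fun d => exists_forall_formula (A := A) (B := B) hV (χ d) (hχ d)
  obtain ⟨θ, hθ, h⟩ := exists_exists_formula (A := A) (B := B) hV χ' hχ'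
  refine ⟨θ, hθ, fun s => ?_⟩
  rw [h]
  simp only [h']
  obtain ⟨d, hd⟩ := hsec s
  constructor
  · rintro ⟨d', hd'⟩
    by_contra hs
    have hn : ¬ P (sec d) := fun hp =>
      hs (hP _ _ (fun φ hφ hf => (hd φ hφ hf).symm) hp)
    exact h2 d' ⟨d, hn⟩ ((hd _ (hχ _ _).1 (hχ _ _).2).1 (hd' ⟨d, hn⟩))
  · intro hs
    have hp : P (sec d) := hP _ _ hd hs
    exact ⟨⟨d, hp⟩, fun e => (hd _ (hχ _ _).1 (hχ _ _).2).2 (h1 _ e)⟩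

end Definability

/-! ### Guarded formulas count colors -/

section CountingFormula

variable {L : FirstOrder.Language.{uF, uR}}

/-- In `w`, a position tied by `S` carries a variable of `z` and every other position its own
quantified variable. Witnesses then correspond to tuples of `R` satisfying at least the equalities
in `S`; `hα` makes these equalities consistent. -/
theorem card_eq_of_extend {X : Type u} [L.Structure X] {k l m : ℕ} {z : Fin k → ℕ}
    {S : Set (ℕ × ℕ)} (hS : ∀ p ∈ S, p.1 < k ∧ p.2 < l) {w : Fin l → ℕ} {y : Fin m → ℕ}
    (hy : Function.Injective y)
    (hw : ∀ j : Fin l, (∃ p, w j = y p) ∨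
      ((∀ p, y p ≠ w j) ∧ ∃ i : Fin k, ((i : ℕ), (j : ℕ)) ∈ S ∧ w j = z i))
    (hyS : ∀ p (j : Fin l) (i : Fin k), w j = y p → ((i : ℕ), (j : ℕ)) ∉ S)
    {e : Fin m → Fin l} (he : ∀ p, w (e p) = y p) (hwe : ∀ p j, w j = y p → j = e p)
    {R : L.Relations l} {α : ℕ → X}
    (hα : ∀ (i i' : Fin k) (j : Fin l), ((i : ℕ), (j : ℕ)) ∈ S → ((i' : ℕ), (j : ℕ)) ∈ S →
      α (z i) = α (z i')) {Q : Tuple X → Prop} {ψ : Formula L}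
    (hψ : ∀ α : ℕ → X, ψ.Sat α ↔ Q ⟨l, fun i => α (w i)⟩) :
    {a : Fin m → X | (Structure.RelMap R fun i => Function.extend y a α (w i)) ∧
      ψ.Sat (Function.extend y a α)}.ncard =
    Nat.card {b : {b : Fin l → X // Structure.RelMap R b} //
      S ⊆ stp (fun i => α (z i)) b.1 ∧ Q ⟨l, b.1⟩} := by
  rw [← Nat.card_coe_set_eq]
  refine Nat.card_congr ⟨fun a => ⟨⟨fun i => Function.extend y a.1 α (w i), a.2.1⟩, ?_, ?_⟩,
    fun b => ⟨fun p => b.1.1 (e p), ?_⟩, ?_, ?_⟩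
  · rintro ⟨i, j⟩ hij
    obtain ⟨hi, hj⟩ := hS _ hij
    lift i to Fin k using hi
    lift j to Fin l using hj
    refine mem_stp_iff.2 ?_
    change α (z i) = Function.extend y a.1 α (w j)
    obtain ⟨p, hp⟩ | ⟨hn, i', hi', hz⟩ := hw j
    · exact absurd hij (hyS p j i hp)
    · rw [Function.extend_apply' _ _ _ fun ⟨p, hp⟩ => hn p hp, hz]
      exact hα i i' j hij hi'
  · exact (hψ _).1 a.2.2
  all_goals
    have key : ∀ b : {b : {b : Fin l → X // Structure.RelMap R b} //
        S ⊆ stp (fun i => α (z i)) b.1 ∧ Q ⟨l, b.1⟩},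
        (fun j => Function.extend y (fun p => b.1.1 (e p)) α (w j)) = b.1.1 := by
      intro b
      funext j
      obtain ⟨p, hp⟩ | ⟨hn, i, hi, hz⟩ := hw j
      · rw [hp, hy.extend_apply, ← hwe p j hp]
      · rw [Function.extend_apply' _ _ _ fun ⟨p, hp⟩ => hn p hp, hz]
        exact mem_stp_iff.1 (b.2.1 hi)
  · refine ⟨?_, (hψ _).2 ?_⟩
    · rw [key b]
      exact b.1.2
    · rw [key b]
      exact b.2.2
  · intro a
    refine Subtype.ext (funext fun p => ?_)
    change Function.extend y a.1 α (w (e p)) = a.1 p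
    rw [he, hy.extend_apply]
  · intro b
    exact Subtype.ext (Subtype.ext (key b))

theorem exists_quantifier_prefix {k : ℕ} (z : Fin k → ℕ) (l : ℕ) (S : Set (ℕ × ℕ)) :
    ∃ (m : ℕ) (w : Fin l → ℕ) (y : Fin m → ℕ) (e : Fin m → Fin l), Function.Injective y ∧
      (∀ j : Fin l, (∃ p, w j = y p) ∨
        ((∀ p, y p ≠ w j) ∧ ∃ i : Fin k, ((i : ℕ), (j : ℕ)) ∈ S ∧ w j = z i)) ∧
      (∀ p (j : Fin l) (i : Fin k), w j = y p → ((i : ℕ), (j : ℕ)) ∉ S) ∧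
      (∀ p, w (e p) = y p) ∧ ∀ p j, w j = y p → j = e p := by
  classical
  obtain ⟨M, hM⟩ := (Set.finite_range z).bddAbove
  have hM' : ∀ i, z i ≤ M := fun i => hM ⟨i, rfl⟩
  let F := {j : Fin l // ¬ ∃ i : Fin k, ((i : ℕ), (j : ℕ)) ∈ S}
  let e := (Fintype.equivFin F).symm
  -- All variables of `z` are at most `M`, so `M + 1 + j` is fresh, and distinct for distinct
  -- positions.
  let w : Fin l → ℕ := fun j => if h : ∃ i : Fin k, ((i : ℕ), (j : ℕ)) ∈ S then z h.choose
    else M + 1 + j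
  have hw1 : ∀ j : Fin l, (∃ i : Fin k, ((i : ℕ), (j : ℕ)) ∈ S) → w j ≤ M := fun j h => by
    simp only [w, dif_pos h]
    exact hM' _
  have hw2 : ∀ j : Fin l, (¬ ∃ i : Fin k, ((i : ℕ), (j : ℕ)) ∈ S) → w j = M + 1 + j := fun j h => by
    simp only [w, dif_neg h]
  have hwe : ∀ p j, w j = w (e p).1 → j = (e p).1 := by
    intro p j h
    rw [hw2 _ (e p).2] at h
    by_cases hj : ∃ i : Fin k, ((i : ℕ), (j : ℕ)) ∈ S
    · have := hw1 j hj
      omega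
    · rw [hw2 j hj] at h
      exact Fin.ext (by omega)
  refine ⟨_, w, fun p => w (e p).1, fun p => (e p).1, ?_, ?_, ?_, fun p => rfl, hwe⟩
  · intro p q h
    exact e.injective (Subtype.ext (hwe q _ h))
  · intro j
    by_cases hj : ∃ i : Fin k, ((i : ℕ), (j : ℕ)) ∈ S
    · refine Or.inr ⟨fun p h => ?_, hj.choose, hj.choose_spec, by simp only [w, dif_pos hj]⟩
      have h1 := hw1 j hj
      have h2 := hw2 _ (e p).2
      have h3 : w (e p).1 = w j := h
      omega
    · exact Or.inl ⟨e.symm ⟨j, hj⟩, by simp⟩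
  · intro p j i h hi
    rw [hwe p j h] at hi
    exact (e p).2 ⟨i, hi⟩

variable {A : Type u} [L.Structure A] {B : Type v} [L.Structure B]

/-- The thresholds `n ≥ 1` determine a finite count. If `S` is out of range or ties one position to
different values, both counts vanish; equality atoms ensure that the latter happens on both sides at
once. -/
theorem GuardedAgree.card_rel_eq {k l : ℕ} {z : Fin k → ℕ} {α : ℕ → A} {β : ℕ → B}
    (h : GuardedAgree L (Set.range z) α β) (R : L.Relations l) (S : Set (ℕ × ℕ))
    {P : Tuple A → Prop} {Q : Tuple B → Prop}
    (hPQ : ∀ w : Fin l → ℕ, ∃ ψ : Formula L, (ψ.IsGuarded ∧ ψ.free ⊆ Set.range w) ∧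
      (∀ α : ℕ → A, ψ.Sat α ↔ P ⟨l, fun i => α (w i)⟩) ∧
      ∀ β : ℕ → B, ψ.Sat β ↔ Q ⟨l, fun i => β (w i)⟩) :
    Nat.card {b : {b : Fin l → A // Structure.RelMap R b} //
      S ⊆ stp (fun i => α (z i)) b.1 ∧ P ⟨l, b.1⟩} =
    Nat.card {b : {b : Fin l → B // Structure.RelMap R b} //
      S ⊆ stp (fun i => β (z i)) b.1 ∧ Q ⟨l, b.1⟩} := by
  by_cases hS : ∀ p ∈ S, p.1 < k ∧ p.2 < l
  swap
  · have e1 : IsEmpty {b : {b : Fin l → A // Structure.RelMap R b} //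
        S ⊆ stp (fun i => α (z i)) b.1 ∧ P ⟨l, b.1⟩} := by
      refine ⟨fun b => hS fun p hp => ?_⟩
      obtain ⟨i, j, rfl, -⟩ := b.2.1 hp
      exact ⟨i.2, j.2⟩
    have e2 : IsEmpty {b : {b : Fin l → B // Structure.RelMap R b} //
        S ⊆ stp (fun i => β (z i)) b.1 ∧ Q ⟨l, b.1⟩} := by
      refine ⟨fun b => hS fun p hp => ?_⟩
      obtain ⟨i, j, rfl, -⟩ := b.2.1 hp
      exact ⟨i.2, j.2⟩
    rw [Nat.card_of_isEmpty, Nat.card_of_isEmpty]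
  have hz : ∀ i i', α (z i) = α (z i') ↔ β (z i) = β (z i') := fun i i' =>
    h (.eq (z i) (z i')) trivial (by
      rintro _ (rfl | rfl)
      exacts [⟨i, rfl⟩, ⟨i', rfl⟩])
  by_cases hα : ∀ (i i' : Fin k) (j : Fin l), ((i : ℕ), (j : ℕ)) ∈ S → ((i' : ℕ), (j : ℕ)) ∈ S →
      α (z i) = α (z i')
  swap
  · push Not at hα
    obtain ⟨i, i', j, h1, h2, h3⟩ := hα
    have e1 : IsEmpty {b : {b : Fin l → A // Structure.RelMap R b} //
        S ⊆ stp (fun i => α (z i)) b.1 ∧ P ⟨l, b.1⟩} :=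
      ⟨fun b => h3 ((mem_stp_iff.1 (b.2.1 h1)).trans (mem_stp_iff.1 (b.2.1 h2)).symm)⟩
    have e2 : IsEmpty {b : {b : Fin l → B // Structure.RelMap R b} //
        S ⊆ stp (fun i => β (z i)) b.1 ∧ Q ⟨l, b.1⟩} :=
      ⟨fun b => h3 ((hz i i').2
        ((mem_stp_iff.1 (b.2.1 h1)).trans (mem_stp_iff.1 (b.2.1 h2)).symm))⟩
    rw [Nat.card_of_isEmpty, Nat.card_of_isEmpty]
  obtain ⟨m, w, y, e, hy, hw, hyS, he, hwe⟩ := exists_quantifier_prefix z l S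
  obtain ⟨ψ, ⟨hψ1, hψ2⟩, hP, hQ⟩ := hPQ w
  have c1 := card_eq_of_extend hS hy hw hyS he hwe (R := R) hα hP
  have c2 := card_eq_of_extend hS hy hw hyS he hwe (R := R)
    (fun i i' j h1 h2 => (hz i i').1 (hα i i' j h1 h2)) hQ
  rw [← c1, ← c2]
  have key : ∀ n, 1 ≤ n → (n ≤ {a : Fin m → A | (Structure.RelMap R fun i =>
      Function.extend y a α (w i)) ∧ ψ.Sat (Function.extend y a α)}.ncard ↔
      n ≤ {b : Fin m → B | (Structure.RelMap R fun i =>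
      Function.extend y b β (w i)) ∧ ψ.Sat (Function.extend y b β)}.ncard) := by
    intro n hn
    refine h (.existsGe n y R w ψ) ⟨hn, hy, ?_, hψ2, hψ1⟩ ?_
    · rintro _ ⟨p, rfl⟩
      exact ⟨e p, he p⟩
    · rintro _ ⟨⟨j, rfl⟩, hj⟩
      obtain ⟨p, hp⟩ | ⟨-, i, -, hi⟩ := hw j
      · exact absurd ⟨p, hp.symm⟩ hj
      · exact ⟨i, hi.symm⟩
  refine le_antisymm ?_ ?_
  · obtain h0 | h1 := Nat.eq_zero_or_pos ({a : Fin m → A | (Structure.RelMap R fun i =>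
      Function.extend y a α (w i)) ∧ ψ.Sat (Function.extend y a α)}.ncard)
    · rw [h0]
      exact Nat.zero_le _
    · exact (key _ h1).1 le_rfl
  · obtain h0 | h1 := Nat.eq_zero_or_pos ({b : Fin m → B | (Structure.RelMap R fun i =>
      Function.extend y b β (w i)) ∧ ψ.Sat (Function.extend y b β)}.ncard)
    · rw [h0]
      exact Nat.zero_le _
    · exact (key _ h1).2 le_rfl

variable [Finite A] [Finite B] [Finite (Σ k : ℕ, L.Relations k)]

/-- Formulas control the tuples whose similarity type contains `S`; inversion over inclusion gives
equality. Positive arity provides the variable that a color formula needs. -/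
theorem GuardedAgree.card_stp_eq [IsEmpty (L.Relations 0)] {k : ℕ} {z : Fin k → ℕ} {α : ℕ → A}
    {β : ℕ → B} (h : GuardedAgree L (Set.range z) α β) {i : ℕ}
    (hdef : ∀ {l : ℕ} (w : Fin l → ℕ) (c : Color L i), 0 < l → ∃ ψ : Formula L,
      (ψ.IsGuarded ∧ ψ.free ⊆ Set.range w) ∧
      (∀ α : ℕ → A, ψ.Sat α ↔ col L A i ⟨l, fun i => α (w i)⟩ = c) ∧
      ∀ β : ℕ → B, ψ.Sat β ↔ col L B i ⟨l, fun i => β (w i)⟩ = c)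
    (S : Set (ℕ × ℕ)) (c : Color L i) :
    Nat.card {y : tuples L A // stp (fun i => α (z i)) y.1.2 = S ∧ col L A i y = c} =
    Nat.card {y : tuples L B // stp (fun i => β (z i)) y.1.2 = S ∧ col L B i y = c} := by
  obtain hc | ⟨⟨l, R⟩, hc⟩ := (colorAtp i c).eq_empty_or_nonempty
  · have e1 := isEmpty_col_of_colorAtp_eq_empty (A := A) hc
      (fun y => stp (fun i => α (z i)) y.1.2 = S)
    have e2 := isEmpty_col_of_colorAtp_eq_empty (A := B) hc
      (fun y => stp (fun i => β (z i)) y.1.2 = S)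
    rw [Nat.card_of_isEmpty, Nat.card_of_isEmpty]
  have hl : 0 < l := by
    refine Nat.pos_of_ne_zero ?_
    rintro rfl
    exact isEmptyElim R
  have hupper : ∀ T, Nat.card {y : tuples L A // T ⊆ stp (fun i => α (z i)) y.1.2 ∧
      col L A i y = c} = Nat.card {y : tuples L B // T ⊆ stp (fun i => β (z i)) y.1.2 ∧
      col L B i y = c} := by
    intro T
    rw [card_eq_card_rel hc (fun y => T ⊆ stp (fun i => α (z i)) y.2),
      card_eq_card_rel hc (fun y => T ⊆ stp (fun i => β (z i)) y.2)]
    exact h.card_rel_eq R T (P := fun y => col L A i y = c) (Q := fun y => col L B i y = c)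
      fun w => hdef w c hl
  have key := card_fiber_eq_of_card_upper
    (fun y : {y : tuples L A // col L A i y = c} => stp (fun i => α (z i)) y.1.1.2)
    (fun y : {y : tuples L B // col L B i y = c} => stp (fun i => β (z i)) y.1.1.2)
    (fun _ => True) (fun _ _ _ _ => trivial) (fun T _ => by
      have := hupper T
      rw [card_subtype_subtype (fun y : tuples L A => col L A i y = c)
        (fun y : tuples L A => T ≤ stp (fun i => α (z i)) y.1.2),
        card_subtype_subtype (fun y : tuples L B => col L B i y = c)
        (fun y : tuples L B => T ≤ stp (fun i => β (z i)) y.1.2)]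
      simpa only [and_comm] using this) S trivial
  rw [card_subtype_subtype (fun y : tuples L A => col L A i y = c)
    (fun y : tuples L A => stp (fun i => α (z i)) y.1.2 = S),
    card_subtype_subtype (fun y : tuples L B => col L B i y = c)
    (fun y : tuples L B => stp (fun i => β (z i)) y.1.2 = S)] at key
  simpa only [and_comm] using key

theorem GuardedAgree.atp_stp_eq {k : ℕ} {z : Fin k → ℕ} {α : ℕ → A}
    {β : ℕ → B} (h : GuardedAgree L (Set.range z) α β) :
    col L A 0 ⟨k, fun i => α (z i)⟩ = col L B 0 ⟨k, fun i => β (z i)⟩ := by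
  refine Prod.ext (Set.ext fun T => ?_) (Set.ext fun p => ?_)
  · refine exists_congr fun R => and_congr_right fun _ => h (.rel R z) trivial subset_rfl
  · refine exists_congr fun i => exists_congr fun j => and_congr_right fun _ =>
      h (.eq (z i) (z j)) trivial ?_
    rintro _ (rfl | rfl)
    exacts [⟨i, rfl⟩, ⟨j, rfl⟩]

/-- The color of the tuple of values of the variables `z`, in either structure. -/
noncomputable def colOn (L : FirstOrder.Language.{uF, uR}) [Finite (Σ k : ℕ, L.Relations k)]
    {A : Type u} [L.Structure A] {B : Type v} [L.Structure B] [Finite A] [Finite B]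
    (i : ℕ) {k : ℕ} (z : Fin k → ℕ) : (ℕ → A) ⊕ (ℕ → B) → Color L i :=
  Sum.elim (fun α => col L A i ⟨k, fun i => α (z i)⟩) (fun β => col L B i ⟨k, fun i => β (z i)⟩)

variable [Nonempty A] [Nonempty B]

theorem exists_color_formula {i : ℕ} (hi : ∀ {k : ℕ} (z : Fin k → ℕ) (s t : (ℕ → A) ⊕ (ℕ → B)),
    (∀ φ : Formula L, φ.IsGuarded → φ.free ⊆ Set.range z → (φ.SatOn s ↔ φ.SatOn t)) →
    colOn L i z s = colOn L i z t) {l : ℕ} (w : Fin l → ℕ) (c : Color L i) (hl : 0 < l) :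
    ∃ ψ : Formula L, (ψ.IsGuarded ∧ ψ.free ⊆ Set.range w) ∧
      (∀ α : ℕ → A, ψ.Sat α ↔ col L A i ⟨l, fun i => α (w i)⟩ = c) ∧
      ∀ β : ℕ → B, ψ.Sat β ↔ col L B i ⟨l, fun i => β (w i)⟩ = c := by
  obtain ⟨χ, hχ, h⟩ := exists_formula_of_invariant (A := A) (B := B) (L := L)
    (V := Set.range w) ⟨_, ⟨0, hl⟩, rfl⟩ (Set.finite_range w) (fun s => colOn L i w s = c)
    (fun s t hst hs => (hi w s t hst).symm.trans hs)
  exact ⟨χ, hχ, fun α => h (Sum.inl α), fun β => h (Sum.inr β)⟩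

/-- Invariance of round `i` makes its colors definable, so their counts are expressible and round `i
+ 1` is invariant. Pairs within one structure are included because definability has to separate
those as well. -/
theorem colOn_eq_of_agree [IsEmpty (L.Relations 0)] (i : ℕ) {k : ℕ} (z : Fin k → ℕ)
    (s t : (ℕ → A) ⊕ (ℕ → B))
    (h : ∀ φ : Formula L, φ.IsGuarded → φ.free ⊆ Set.range z → (φ.SatOn s ↔ φ.SatOn t)) :
    colOn L i z s = colOn L i z t := by
  induction i generalizing k z s t with
  | zero =>
    rcases s with α | α <;> rcases t with β | β
    all_goals exact GuardedAgree.atp_stp_eq h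
  | succ i ih =>
    have h1 := ih z s t h
    have h2 := fun {l : ℕ} (w : Fin l → ℕ) (c : Color L i) (hl : 0 < l) =>
      exists_color_formula (fun z s t => ih z s t) w c hl
    rcases s with α | α <;> rcases t with β | β
    · refine (col_succ_eq_iff L).2 ⟨h1, fun S _ c => GuardedAgree.card_stp_eq h ?_ S c⟩
      intro l w c hl
      obtain ⟨ψ, hψ, hA, hB⟩ := h2 w c hl
      exact ⟨ψ, hψ, hA, hA⟩
    · exact (col_succ_eq_iff L).2 ⟨h1, fun S _ c => GuardedAgree.card_stp_eq h h2 S c⟩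
    · refine (col_succ_eq_iff L).2 ⟨h1, fun S _ c => GuardedAgree.card_stp_eq h ?_ S c⟩
      intro l w c hl
      obtain ⟨ψ, hψ, hA, hB⟩ := h2 w c hl
      exact ⟨ψ, hψ, hB, hA⟩
    · refine (col_succ_eq_iff L).2 ⟨h1, fun S _ c => GuardedAgree.card_stp_eq h ?_ S c⟩
      intro l w c hl
      obtain ⟨ψ, hψ, hA, hB⟩ := h2 w c hl
      exact ⟨ψ, hψ, hB, hB⟩

theorem GuardedEquivalent.not_distinguishes [IsEmpty (L.Relations 0)]
    (h : GuardedEquivalent L A B) : ¬ Distinguishes L A B := by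
  refine not_distinguishes_iff.2 fun i c => ?_
  have h0 : GuardedAgree L (Set.range (Fin.elim0 : Fin 0 → ℕ))
      (fun _ => Classical.arbitrary A) (fun _ => Classical.arbitrary B) := by
    intro φ hφ hf
    have hf' : φ.free = ∅ := by simpa using hf
    have e1 := fun α β : ℕ → A => φ.sat_congr hφ (α := α) (β := β) (by simp [hf'])
    have e2 := fun α β : ℕ → B => φ.sat_congr hφ (α := α) (β := β) (by simp [hf'])
    have h1 := h φ hφ hf'
    exact ⟨fun ha => h1.1 (fun α => (e1 _ _).1 ha) _, fun hb => h1.2 (fun β => (e2 _ _).1 hb) _⟩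
  have := h0.card_stp_eq (i := i) (fun w c hl =>
    exists_color_formula (fun z s t => colOn_eq_of_agree i z s t) w c hl) ∅ c
  rw [colorCount_eq, colorCount_eq]
  simpa only [stp_of_length_zero, true_and] using this

end CountingFormula

/-! ### Rooting a tree -/

section RootedTree

/-- Rank is the distance to an arbitrary root, the parent the next vertex on a shortest walk there.
Uniqueness of paths makes every edge a parent edge. -/
theorem exists_parent_of_isTree {V : Type*} {G : SimpleGraph V} (hG : G.IsTree) :
    ∃ (r : V) (p : V → V) (rank : V → ℕ), (∀ x, x ≠ r → rank (p x) < rank x) ∧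
      ∀ x y, G.Adj x y → (x ≠ r ∧ p x = y) ∨ (y ≠ r ∧ p y = x) := by
  obtain ⟨r⟩ := hG.connected.nonempty
  choose q hq using fun x => hG.connected.exists_walk_length_eq_dist x r
  have key : ∀ x y, G.Adj x y → G.dist r x = G.dist r y + 1 → x ≠ r ∧ (q x).snd = y := by
    intro x y hxy h
    have h1 : x ≠ r := by
      rintro rfl
      simp at h
    have h2 : (SimpleGraph.Walk.cons hxy (q y)).IsPath := by
      apply SimpleGraph.Walk.isPath_of_length_eq_dist
      rw [SimpleGraph.Walk.length_cons, hq, SimpleGraph.dist_comm (u := y),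
        SimpleGraph.dist_comm (u := x), h]
    have h3 := (q x).isPath_of_length_eq_dist (hq x)
    rw [(hG.existsUnique_path x r).unique h3 h2]
    exact ⟨h1, by simp⟩
  refine ⟨r, fun x => (q x).snd, fun x => G.dist r x, fun x hx => ?_, fun x y hxy => ?_⟩
  · have h1 := (q x).adj_snd (SimpleGraph.Walk.not_nil_of_ne hx)
    have h2 := (q x).length_tail_add_one (SimpleGraph.Walk.not_nil_of_ne hx)
    have h3 := SimpleGraph.dist_le (q x).tail
    rw [hq] at h2
    change G.dist r (q x).snd < G.dist r x
    rw [SimpleGraph.dist_comm (u := r), SimpleGraph.dist_comm (u := r)]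
    omega
  · obtain h | h := hG.dist_eq_dist_add_one_of_adj r hxy
    · exact Or.inl (key x y hxy h)
    · exact Or.inr (key y x hxy.symm h)

theorem exists_rec_of_parent {V : Type*} {Y : Type*} {r : V} {p : V → V} {rank : V → ℕ}
    (hp : ∀ x, x ≠ r → rank (p x) < rank x) (y₀ : Y) (step : V → Y → Y) :
    ∃ g : V → Y, g r = y₀ ∧ ∀ x, x ≠ r → g x = step x (g (p x)) := by
  classical
  let F : ∀ x, (∀ z, rank z < rank x → Y) → Y := fun x ih =>
    if h : x = r then y₀ else step x (ih (p x) (hp x h))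
  refine ⟨(measure rank).wf.fix F, ?_, fun x hx => ?_⟩
  · rw [WellFounded.fix_eq]
    simp only [F, dif_pos]
  · rw [WellFounded.fix_eq]
    simp only [F, dif_neg hx]

theorem eq_of_reachable {V : Type*} {Y : Type*} {G : SimpleGraph V} {F : V → Y}
    (hF : ∀ x y, G.Adj x y → F x = F y) {x y : V} (h : G.Reachable x y) : F x = F y := by
  obtain ⟨w⟩ := h
  induction w with
  | nil => rfl
  | cons hadj _ ih => exact (hF _ _ hadj).trans ih

end RootedTree

/-! ### Transporting homomorphisms along a bisimulation -/

section HomCount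

variable {L : FirstOrder.Language.{uF, uR}}
variable {A : Type u} [L.Structure A] {B : Type v} [L.Structure B] {C : Type w} [L.Structure C]

/-- The image of a tuple under a homomorphism. -/
def mapTuple (h : C →[L] A) (c : tuples L C) : tuples L A :=
  ⟨⟨c.1.1, fun i => h (c.1.2 i)⟩, let ⟨R, hR⟩ := c.2; ⟨R, h.map_rel R _ hR⟩⟩

theorem hom_eq_of_mapTuple_eq (hC : Covered L C) {h h' : C →[L] A}
    (heq : ∀ c, mapTuple h c = mapTuple h' c) : h = h' := by
  refine DFunLike.ext _ _ fun x => ?_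
  obtain ⟨t, ht, i, rfl⟩ := hC x
  have := congrArg Subtype.val (heq ⟨t, ht⟩)
  exact congrFun (eq_of_heq (Sigma.mk.inj this).2) i

/-- Read the value of `x` off any tuple containing `x`. The choice is immaterial: values agree along
edges, and the tuples containing `x` are connected. -/
theorem exists_hom_of_consistent [L.IsRelational] (hC : Covered L C)
    {J : SimpleGraph (tuples L C)}
    (hJ : ∀ x : C, (J.induce {c | x ∈ Set.range c.1.2}).Connected)
    (g : tuples L C → tuples L B) (u : ∀ c : tuples L C, Fin c.1.1 → B)
    (hgu : ∀ c, (g c).1 = ⟨c.1.1, u c⟩) (hatp : ∀ c : tuples L C, atp L c.1.2 ⊆ atp L (g c).1.2)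
    (hself : ∀ c i j, c.1.2 i = c.1.2 j → u c i = u c j)
    (hadj : ∀ c c', J.Adj c c' → ∀ i j, c.1.2 i = c'.1.2 j → u c i = u c' j) :
    ∃ h : C →[L] B, ∀ c, g c = mapTuple h c := by
  choose t ht i hi using hC
  have key : ∀ (c : tuples L C) (j : Fin c.1.1), u ⟨t (c.1.2 j), ht _⟩ (i _) = u c j := by
    intro c j
    have hconn := hJ (c.1.2 j)
    let F : {c' : tuples L C | c.1.2 j ∈ Set.range c'.1.2} → B := fun c' => u c'.1 c'.2.choose
    have hF : ∀ (c' : {c' : tuples L C | c.1.2 j ∈ Set.range c'.1.2}) (j' : Fin c'.1.1.1),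
        c'.1.1.2 j' = c.1.2 j → u c'.1 j' = F c' := fun c' j' hj' =>
      hself _ _ _ (hj'.trans c'.2.choose_spec.symm)
    have h1 := eq_of_reachable (F := F) (fun c₁ c₂ h12 => hadj _ _ h12 _ _
      (c₁.2.choose_spec.trans c₂.2.choose_spec.symm))
      (hconn.preconnected ⟨⟨t (c.1.2 j), ht _⟩, ⟨i _, hi _⟩⟩ ⟨c, ⟨j, rfl⟩⟩)
    rw [← hF _ _ (hi _), ← hF ⟨c, ⟨j, rfl⟩⟩ j rfl] at h1
    exact h1
  refine ⟨⟨fun x => u ⟨t x, ht x⟩ (i x), fun f => isEmptyElim f, fun {k} R x hR => ?_⟩,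
    fun c => ?_⟩
  · have h1 := hatp ⟨⟨k, x⟩, R, hR⟩ (mem_atp_iff.2 hR)
    rw [hgu] at h1
    have h2 := mem_atp_iff.1 h1
    convert h2 using 1
    funext j
    exact key ⟨⟨k, x⟩, R, hR⟩ j
  · refine Subtype.ext ?_
    rw [hgu]
    have : u c = fun j => u ⟨t (c.1.2 j), ht _⟩ (i _) := funext fun j => (key c j).symm
    rw [this]
    rfl

/-- Move the root tuple by `σ` and each further tuple by the bijection belonging to the two images
of its parent, which preserves overlaps along the edge. With `σ` and `π` fixed beforehand, `h` can
be recovered from `h'`, root first. -/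
theorem IsBisim.exists_hom [L.IsRelational] {E : tuples L A → tuples L B → Prop}
    (hE : IsBisim L E) (hC : Covered L C) {J : SimpleGraph (tuples L C)}
    (hJ : ∀ x : C, (J.induce {c | x ∈ Set.range c.1.2}).Connected)
    {r : tuples L C} {p : tuples L C → tuples L C} {rank : tuples L C → ℕ}
    (hp : ∀ x, x ≠ r → rank (p x) < rank x)
    (hadj : ∀ x y, J.Adj x y → (x ≠ r ∧ p x = y) ∨ (y ≠ r ∧ p y = x))
    {σ : tuples L A ≃ tuples L B} (hσ : ∀ y, E y (σ y))
    {π : tuples L A → tuples L B → (tuples L A ≃ tuples L B)}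
    (hπ : ∀ a b, E a b → ∀ y, stp a.1.2 y.1.2 = stp b.1.2 (π a b y).1.2 ∧ E y (π a b y))
    (h : C →[L] A) : ∃ h' : C →[L] B, mapTuple h' r = σ (mapTuple h r) ∧
      ∀ c, c ≠ r →
        mapTuple h' c = π (mapTuple h (p c)) (mapTuple h' (p c)) (mapTuple h c) := by
  obtain ⟨g, hgr, hg⟩ := exists_rec_of_parent hp (σ (mapTuple h r))
    (fun c b => π (mapTuple h (p c)) b (mapTuple h c))
  have hEg : ∀ c, E (mapTuple h c) (g c) := by
    intro c
    induction hn : rank c using Nat.strong_induction_on generalizing c with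
    | _ n ih =>
      by_cases hc : c = r
      · rw [hc, hgr]
        exact hσ _
      · rw [hg c hc]
        exact (hπ _ _ (ih _ (hn ▸ hp c hc) (p c) rfl) _).2
  have hu : ∀ c, ∃ u : Fin c.1.1 → B, (g c).1 = ⟨c.1.1, u⟩ := by
    intro c
    have h1 : (g c).1.1 = c.1.1 := hE.length_eq (hEg c)
    generalize (g c).1 = q at h1
    obtain ⟨l', q⟩ := q
    obtain rfl : l' = c.1.1 := h1
    exact ⟨q, rfl⟩
  choose u hu using hu
  have hstep : ∀ c, c ≠ r → ∀ i j, (p c).1.2 i = c.1.2 j → u (p c) i = u c j := by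
    intro c hc i j hij
    have h1 := (hπ _ _ (hEg (p c)) (mapTuple h c)).1
    rw [← hg c hc, hu, hu] at h1
    refine (mem_stp_iff (a := u (p c)) (b := u c)).1 ?_
    rw [← h1]
    exact mem_stp_iff.2 (congrArg h hij)
  have hatp : ∀ c : tuples L C, atp L c.1.2 ⊆ atp L (g c).1.2 := by
    intro c
    rw [← hE.atp_eq _ _ (hEg c)]
    rintro _ ⟨R, rfl, hR⟩
    exact mem_atp_iff.2 (h.map_rel R _ hR)
  have hself : ∀ c i j, c.1.2 i = c.1.2 j → u c i = u c j := by
    intro c i j hij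
    have h1 := hE.stp_eq (hEg c)
    rw [hu] at h1
    refine (mem_stp_iff (a := u c) (b := u c)).1 ?_
    rw [← h1]
    exact mem_stp_iff.2 (congrArg h hij)
  have hcons : ∀ c c', J.Adj c c' → ∀ i j, c.1.2 i = c'.1.2 j → u c i = u c' j := by
    intro c c' hcc i j hij
    obtain ⟨h1, rfl⟩ | ⟨h1, rfl⟩ := hadj _ _ hcc
    · exact (hstep c h1 j i hij.symm).symm
    · exact hstep c' h1 i j hij
  obtain ⟨h', hh'⟩ := exists_hom_of_consistent hC hJ g u hu hatp hself hcons
  refine ⟨h', ?_, fun c hc => ?_⟩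
  · rw [← hh', hgr]
  · rw [← hh', ← hh', hg c hc]

theorem IsBisim.card_hom_le [L.IsRelational] [Finite C] [Finite B]
    {E : tuples L A → tuples L B → Prop} (hE : IsBisim L E) (hC : Covered L C)
    (hac : IsAcyclic L C) : Nat.card (C →[L] A) ≤ Nat.card (C →[L] B) := by
  classical
  obtain ⟨J, hT, hJ⟩ := hac
  obtain ⟨r, p, rank, hp, hadj⟩ := exists_parent_of_isTree hT
  obtain ⟨σ, hσ⟩ := hE.total
  have hπ : ∀ a b, ∃ π : tuples L A ≃ tuples L B, E a b →
      ∀ y, stp a.1.2 y.1.2 = stp b.1.2 (π y).1.2 ∧ E y (π y) := by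
    intro a b
    by_cases hab : E a b
    · obtain ⟨π, hπ⟩ := hE.forth a b hab
      exact ⟨π, fun _ => hπ⟩
    · exact ⟨σ, fun h => absurd h hab⟩
  choose π hπ using hπ
  choose F hF1 hF2 using hE.exists_hom hC hJ hp hadj hσ hπ
  have : Finite (C →[L] B) := Finite.of_injective (fun h => (h : C → B)) DFunLike.coe_injective
  refine Nat.card_le_card_of_injective F fun h h' hh => hom_eq_of_mapTuple_eq hC fun c => ?_
  induction hn : rank c using Nat.strong_induction_on generalizing c with
  | _ n ih =>
    by_cases hc : c = r
    · subst hc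
      exact σ.injective ((hF1 h).symm.trans (hh ▸ hF1 h'))
    · have h1 := hF2 h c hc
      rw [hh, hF2 h' c hc, ih _ (hn ▸ hp c hc) (p c) rfl] at h1
      exact ((π _ _).injective h1).symm

theorem Bisimilar.homIndistinguishable [L.IsRelational] [Finite A] [Finite B]
    (h : Bisimilar L A B) : HomIndistinguishable.{uF, uR, u, v, w} L A B := by
  intro C _ _ _ hC hac
  obtain ⟨E, hE⟩ := h
  exact le_antisymm (hE.card_hom_le hC hac) (hE.flip.card_hom_le hC hac)

end HomCount

/-! ### Join-trees from rooted decompositions -/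

section JoinTree

theorem rank_root_lt {N : Type*} {r : N} {p : N → N} {rank : N → ℕ}
    (hp : ∀ n, n ≠ r → rank (p n) < rank n) {n : N} (hn : n ≠ r) : rank r < rank n := by
  induction hk : rank n using Nat.strong_induction_on generalizing n with
  | _ k ih =>
    have h1 := hp n hn
    by_cases h : p n = r
    · rw [← hk, ← h]
      exact h1
    · exact hk ▸ (ih _ (hk ▸ h1) h rfl).trans h1

/-- Every vertex climbs to `r`, and the edges correspond to the vertices other than `r`; ranks
prevent an edge from arising at both ends. -/
theorem isTree_fromRel_parent {V : Type*} [Finite V] {r : V} {p : V → V} {rank : V → ℕ}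
    (hp : ∀ x, x ≠ r → rank (p x) < rank x) :
    (SimpleGraph.fromRel fun x y => x ≠ r ∧ p x = y).IsTree := by
  classical
  have hne : ∀ x, x ≠ r → x ≠ p x := fun x hx h => by
    have := hp x hx
    rw [← h] at this
    exact lt_irrefl _ this
  have hadj : ∀ x, x ≠ r → (SimpleGraph.fromRel fun x y => x ≠ r ∧ p x = y).Adj x (p x) :=
    fun x hx => (SimpleGraph.fromRel_adj _ _ _).2 ⟨hne x hx, Or.inl ⟨hx, rfl⟩⟩
  have hreach : ∀ x, (SimpleGraph.fromRel fun x y => x ≠ r ∧ p x = y).Reachable x r := by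
    intro x
    induction hk : rank x using Nat.strong_induction_on generalizing x with
    | _ k ih =>
      by_cases hx : x = r
      · rw [hx]
      · exact (hadj x hx).reachable.trans (ih _ (hk ▸ hp x hx) _ rfl)
  rw [SimpleGraph.isTree_iff_connected_and_card]
  refine ⟨(SimpleGraph.connected_iff _).2 ⟨fun x y => (hreach x).trans (hreach y).symm, ⟨r⟩⟩, ?_⟩
  rw [← Nat.card_congr (Equiv.optionSubtypeNe r), Finite.card_option]
  congr 1
  refine (Nat.card_eq_of_bijective
    (fun x : {x // x ≠ r} => (⟨s(x.1, p x.1), hadj x.1 x.2⟩ :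
      (SimpleGraph.fromRel fun x y => x ≠ r ∧ p x = y).edgeSet)) ⟨?_, ?_⟩).symm
  · rintro ⟨x, hx⟩ ⟨y, hy⟩ h
    obtain ⟨h1, -⟩ | ⟨h1, h2⟩ := Sym2.eq_iff.1 (congrArg Subtype.val h)
    · exact Subtype.ext h1
    · have e1 := hp x hx
      have e2 := hp y hy
      simp only at h1 h2
      rw [h2] at e1
      rw [← h1] at e2
      exact absurd e1 e2.asymm
  · rintro ⟨e, he⟩
    induction e using Sym2.ind with
    | _ x y =>
      have he' : (SimpleGraph.fromRel fun x y => x ≠ r ∧ p x = y).Adj x y := he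
      obtain ⟨-, ⟨hx, rfl⟩ | ⟨hy, rfl⟩⟩ := (SimpleGraph.fromRel_adj _ _ _).1 he'
      · exact ⟨⟨x, hx⟩, rfl⟩
      · exact ⟨⟨y, hy⟩, Subtype.ext Sym2.eq_swap⟩

variable {L : FirstOrder.Language.{uF, uR}} {C : Type w} [L.Structure C]

/-- A rooted tree decomposition all of whose bags are tuples of the structure yields a join-tree. -/
theorem isAcyclic_of_parent [Finite (tuples L C)] {N : Type*} {r : N} {p : N → N} {rank : N → ℕ}
    (hp : ∀ n, n ≠ r → rank (p n) < rank n) {τ : N → tuples L C} (hτ : Function.Surjective τ)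
    (htop : ∀ x : C, ∃ n₀, x ∈ Set.range (τ n₀).1.2 ∧
      ∀ n, x ∈ Set.range (τ n).1.2 → n ≠ n₀ → n ≠ r ∧ x ∈ Set.range (τ (p n)).1.2) :
    IsAcyclic L C := by
  -- Several nodes may carry the same tuple. A node of least rank represents it, and the label of
  -- that node's parent becomes the parent tuple.
  have hmin : ∀ c, ∃ n, τ n = c ∧ ∀ m, τ m = c → rank n ≤ rank m := by
    intro c
    obtain ⟨n, hn, hm⟩ := (measure rank).wf.has_min {n | τ n = c} (hτ c)
    exact ⟨n, hn, fun m h => not_lt.1 (hm m h)⟩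
  choose first h1 h2 using hmin
  have hroot : ∀ c, c ≠ τ r → first c ≠ r := fun c hc h => hc (by rw [← h, h1])
  have hroot' : ∀ c, first c ≠ r → c ≠ τ r := by
    rintro c hc rfl
    exact absurd (rank_root_lt hp hc) (not_lt.2 (h2 _ r rfl))
  have hp' : ∀ c, c ≠ τ r → rank (first (τ (p (first c)))) < rank (first c) := fun c hc =>
    (h2 _ _ rfl).trans_lt (hp _ (hroot c hc))
  refine ⟨_, isTree_fromRel_parent (p := fun c => τ (p (first c)))
    (rank := fun c => rank (first c)) hp', fun x => ?_⟩
  obtain ⟨n₀, hn₀, hn⟩ := htop x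
  have hreach : ∀ c : {c : tuples L C | x ∈ Set.range c.1.2}, ((SimpleGraph.fromRel fun c c' =>
      c ≠ τ r ∧ τ (p (first c)) = c').induce
      {c : tuples L C | x ∈ Set.range c.1.2}).Reachable c
      ⟨τ n₀, hn₀⟩ := by
    rintro ⟨c, hc⟩
    induction hk : rank (first c) using Nat.strong_induction_on generalizing c with
    | _ k ih =>
      by_cases hfc : first c = n₀
      · have : c = τ n₀ := by rw [← hfc, h1]
        subst this
        rfl
      · obtain ⟨e1, e2⟩ := hn (first c) ((h1 c).symm ▸ hc) hfc
        have e3 := hp' c (hroot' c e1)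
        refine SimpleGraph.Reachable.trans (v := ⟨τ (p (first c)), e2⟩)
          (SimpleGraph.Adj.reachable ?_) (ih _ (hk ▸ e3) _ e2 rfl)
        rw [SimpleGraph.induce_adj, SimpleGraph.fromRel_adj]
        refine ⟨fun h => ?_, Or.inl ⟨hroot' c e1, rfl⟩⟩
        simp only at h
        rw [← h] at e3
        exact lt_irrefl _ e3
  exact (SimpleGraph.connected_iff _).2
    ⟨fun c c' => (hreach c).trans (hreach c').symm, ⟨⟨τ n₀, hn₀⟩⟩⟩

end JoinTree

/-- A rooted tree whose nodes are labelled by relation symbols and whose edges are labelled by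
sets of pairs of positions of the two endpoints. -/
structure LabelledTree (L : FirstOrder.Language.{uF, uR}) where
  /-- The nodes. -/
  N : Type w
  finite : Finite N
  /-- The root. -/
  root : N
  /-- The parent of a node; its value at the root is irrelevant. -/
  parent : N → N
  /-- A rank that decreases toward the root. -/
  rank : N → ℕ
  rank_parent : ∀ n, n ≠ root → rank (parent n) < rank n
  /-- The label of a node. -/
  lab : N → Σ k : ℕ, L.Relations k
  /-- The label of the edge between a node and its parent. -/
  link : N → Set (ℕ × ℕ)
  link_lt : ∀ n, n ≠ root → ∀ q ∈ link n, q.1 < (lab (parent n)).1 ∧ q.2 < (lab n).1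

namespace LabelledTree

variable {L : FirstOrder.Language.{uF, uR}}

attribute [instance] LabelledTree.finite

/-! ### The acyclic structure described by a labelled tree -/

section Realization

variable (t : LabelledTree.{uF, uR, w} L)

/-- One generating identification of positions. -/
inductive Glue : (Σ n : t.N, Fin (t.lab n).1) → (Σ n : t.N, Fin (t.lab n).1) → Prop
  | mk (n : t.N) (hn : n ≠ t.root) (i : Fin (t.lab (t.parent n)).1) (j : Fin (t.lab n).1)
    (h : ((i : ℕ), (j : ℕ)) ∈ t.link n) : Glue ⟨t.parent n, i⟩ ⟨n, j⟩

/-- The universe of the structure described by a tree: the positions of all nodes, identified along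
the edges. -/
def Carrier : Type w := Quot t.Glue

/-- The tuple of a node. -/
def node (n : t.N) : Tuple t.Carrier := ⟨(t.lab n).1, fun i => Quot.mk _ ⟨n, i⟩⟩

instance [L.IsRelational] : L.Structure t.Carrier where
  funMap f := isEmptyElim f
  RelMap {k} R x := ∃ n, t.lab n = ⟨k, R⟩ ∧ (⟨k, x⟩ : Tuple t.Carrier) = t.node n

instance : Finite t.Carrier := Quot.finite _

variable [L.IsRelational]

theorem relMap_node (n : t.N) : Structure.RelMap (t.lab n).2 (t.node n).2 :=
  ⟨n, rfl, rfl⟩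

/-- The tuple of a node, as a tuple of the structure. -/
def nodeTuple (n : t.N) : tuples L t.Carrier := ⟨t.node n, (t.lab n).2, t.relMap_node n⟩

theorem nodeTuple_surjective : Function.Surjective t.nodeTuple := by
  rintro ⟨c, R, n, -, h⟩
  exact ⟨n, Subtype.ext h.symm⟩

theorem covered : Covered L t.Carrier := by
  rintro ⟨n, i⟩
  exact ⟨t.node n, (t.nodeTuple n).2, i, rfl⟩

instance [IsEmpty (L.Relations 0)] : Nonempty t.Carrier := by
  have h : 0 < (t.lab t.root).1 := by
    refine Nat.pos_of_ne_zero fun h => ?_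
    have R := (t.lab t.root).2
    rw [h] at R
    exact isEmptyElim R
  exact ⟨Quot.mk _ ⟨t.root, ⟨0, h⟩⟩⟩

/-- Let `n₀` be a node of least rank containing `x`. If another node `n` contains `x` but is the
root or has a parent without `x`, no chain of identifications for `x` leaves the subtree below `n`.
So `n₀` lies there, with larger rank than `n`: a contradiction. -/
theorem isAcyclic : IsAcyclic L t.Carrier := by
  have : Finite (tuples L t.Carrier) := Finite.of_surjective _ t.nodeTuple_surjective
  refine isAcyclic_of_parent t.rank_parent t.nodeTuple_surjective fun x => ?_
  obtain ⟨n₀, hn₀, hmin⟩ := (measure t.rank).wf.has_min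
    {n | x ∈ Set.range (t.nodeTuple n).1.2} (by
      obtain ⟨n, i⟩ := x
      exact ⟨n, i, rfl⟩)
  refine ⟨n₀, hn₀, fun n hn hne => ?_⟩
  by_contra hcon
  let Desc : t.N → Prop := fun m =>
    Relation.ReflTransGen (fun a b => a ≠ t.root ∧ t.parent a = b) m n
  have hrank : ∀ m, Desc m → m = n ∨ t.rank n < t.rank m := by
    intro m hm
    induction hm using Relation.ReflTransGen.head_induction_on with
    | refl => exact Or.inl rfl
    | head h _ ih =>
      obtain ⟨h1, rfl⟩ := h
      have h2 := t.rank_parent _ h1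
      obtain h3 | h3 := ih
      · exact Or.inr (h3 ▸ h2)
      · exact Or.inr (h3.trans h2)
  have hstep : ∀ a b, Relation.EqvGen t.Glue a b → (Quot.mk t.Glue a : t.Carrier) = x →
      (Desc a.1 ↔ Desc b.1) := by
    intro a b hab
    induction hab with
    | rel a b h =>
      intro hx
      obtain ⟨m, hm, i, j, hij⟩ := h
      constructor
      · exact fun hd => Relation.ReflTransGen.head ⟨hm, rfl⟩ hd
      · intro hd
        obtain hd | ⟨c, ⟨-, rfl⟩, hd⟩ := Relation.ReflTransGen.cases_head hd
        · simp only at hd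
          subst hd
          exact absurd ⟨hm, ⟨i, hx⟩⟩ hcon
        · exact hd
    | refl a => exact fun _ => Iff.rfl
    | symm a b h ih => exact fun hx => (ih ((Quot.eqvGen_sound h).trans hx)).symm
    | trans a b c h h' ih ih' =>
      exact fun hx => (ih hx).trans (ih' ((Quot.eqvGen_sound h).symm.trans hx))
  obtain ⟨i, hi⟩ := hn
  obtain ⟨i₀, hi₀⟩ := hn₀
  have h1 : Desc n₀ := (hstep ⟨n, i⟩ ⟨n₀, i₀⟩ (Quot.eqvGen_exact (hi.trans hi₀.symm)) hi).1
    Relation.ReflTransGen.refl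
  obtain h2 | h2 := hrank n₀ h1
  · exact hne h2.symm
  · exact hmin n ⟨i, hi⟩ h2

end Realization

/-! ### Homomorphisms as matches of a tree -/

section Match

variable {A : Type u} [L.Structure A]

/-- The assignment `f` of tuples to the nodes respects all labels. -/
def IsMatch (t : LabelledTree.{uF, uR, w} L) (f : t.N → tuples L A) : Prop :=
  (∀ n, t.lab n ∈ atp L (f n).1.2) ∧
    ∀ n, n ≠ t.root → t.link n ⊆ stp (f (t.parent n)).1.2 (f n).1.2

variable (A) in
-- The universe is a quotient by the links alone, so choosing compatible tuples at the nodes is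
-- exactly choosing a homomorphism.
theorem card_hom_eq [L.IsRelational] (t : LabelledTree.{uF, uR, w} L) :
    Nat.card (t.Carrier →[L] A) = Nat.card {f : t.N → tuples L A // t.IsMatch f} := by
  refine Nat.card_eq_of_bijective (fun h => ⟨fun n => mapTuple h (t.nodeTuple n), fun n => ?_,
    fun n hn => ?_⟩) ⟨fun h h' hh => hom_eq_of_mapTuple_eq t.covered fun c => ?_, fun f => ?_⟩
  · exact ⟨(t.lab n).2, rfl, h.map_rel _ _ (t.relMap_node n)⟩
  · rintro ⟨i, j⟩ hij
    obtain ⟨hi, hj⟩ := t.link_lt n hn _ hij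
    exact ⟨⟨i, hi⟩, ⟨j, hj⟩, rfl, congrArg h (Quot.sound (Glue.mk n hn ⟨i, hi⟩ ⟨j, hj⟩ hij))⟩
  · obtain ⟨n, rfl⟩ := t.nodeTuple_surjective c
    exact congrFun (congrArg Subtype.val hh) n
  · obtain ⟨f, hf1, hf2⟩ := f
    have hu : ∀ n, ∃ u : Fin (t.lab n).1 → A, (f n).1 = ⟨(t.lab n).1, u⟩ := by
      intro n
      have h1 := length_eq_of_mem_atp (hf1 n)
      generalize (f n).1 = q at h1
      obtain ⟨l', q⟩ := q
      obtain rfl : (t.lab n).1 = l' := h1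
      exact ⟨q, rfl⟩
    choose u hu using hu
    let h : t.Carrier → A := Quot.lift (fun q => u q.1 q.2) (by
      rintro _ _ ⟨n, hn, i, j, hij⟩
      have h1 := hf2 n hn hij
      rw [hu, hu] at h1
      exact (mem_stp_iff (a := u (t.parent n)) (b := u n)).1 h1)
    have hh : ∀ n, (⟨(t.node n).1, fun i => h ((t.node n).2 i)⟩ : Tuple A) = (f n).1 :=
      fun n => (hu n).symm
    refine ⟨⟨h, fun f => isEmptyElim f, fun {k} R x hR => ?_⟩, Subtype.ext (funext fun n =>
      Subtype.ext (hh n))⟩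
    obtain ⟨n, e1, e2⟩ := hR
    have h1 : (⟨k, fun i => h (x i)⟩ : Tuple A) = (f n).1 := by
      rw [← hh, ← e2]
    have h2 := hf1 n
    rw [← h1, e1] at h2
    exact mem_atp_iff.1 h2

/-- The number of matches that send the root to `x`. -/
noncomputable def count (t : LabelledTree.{uF, uR, w} L) (x : tuples L A) : ℕ :=
  Nat.card {f : t.N → tuples L A // t.IsMatch f ∧ f t.root = x}

theorem count_eq_zero {t : LabelledTree.{uF, uR, w} L} {x : tuples L A}
    (h : t.lab t.root ∉ atp L x.1.2) : t.count x = 0 := by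
  have : IsEmpty {f : t.N → tuples L A // t.IsMatch f ∧ f t.root = x} :=
    ⟨fun f => h (f.2.2 ▸ f.2.1.1 t.root)⟩
  exact Nat.card_of_isEmpty

/-- The tree with a single node. -/
def leaf (R : Σ k : ℕ, L.Relations k) : LabelledTree.{uF, uR, w} L where
  N := PUnit
  finite := inferInstance
  root := ⟨⟩
  parent := id
  rank _ := 0
  rank_parent _ h := (h rfl).elim
  lab _ := R
  link _ := ∅
  link_lt _ h := (h rfl).elim

open Classical in
theorem count_leaf (R : Σ k : ℕ, L.Relations k) (x : tuples L A) :
    (leaf.{uF, uR, w} R).count x = if R ∈ atp L x.1.2 then 1 else 0 := by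
  split_ifs with h
  · refine Nat.card_eq_one_iff_unique.2 ⟨⟨fun f g => ?_⟩, ⟨⟨fun _ => x, ⟨fun _ => h, ?_⟩, rfl⟩⟩⟩
    · exact Subtype.ext (funext fun n => f.2.2.trans g.2.2.symm)
    · exact fun _ h => (h rfl).elim
  · exact count_eq_zero h

open Classical in
/-- Attach the second tree below the root of the first one. -/
noncomputable def attach (t₁ : LabelledTree.{uF, uR, w} L) (S : Set (ℕ × ℕ))
    (t₂ : LabelledTree.{uF, uR, w} L)
    (hS : ∀ q ∈ S, q.1 < (t₁.lab t₁.root).1 ∧ q.2 < (t₂.lab t₂.root).1) :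
    LabelledTree.{uF, uR, w} L where
  N := t₁.N ⊕ t₂.N
  finite := inferInstance
  root := Sum.inl t₁.root
  parent := Sum.elim (fun n => Sum.inl (t₁.parent n))
    (fun n => if n = t₂.root then Sum.inl t₁.root else Sum.inr (t₂.parent n))
  rank := Sum.elim t₁.rank (fun n => t₂.rank n + t₁.rank t₁.root + 1)
  rank_parent := by
    rintro (n | n) h
    · exact t₁.rank_parent n fun h' => h (congrArg _ h')
    · by_cases hn : n = t₂.root
      · simp only [Sum.elim_inr, if_pos hn, Sum.elim_inl]
        omega
      · simp only [Sum.elim_inr, if_neg hn]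
        have := t₂.rank_parent n hn
        omega
  lab := Sum.elim t₁.lab t₂.lab
  link := Sum.elim t₁.link (fun n => if n = t₂.root then S else t₂.link n)
  link_lt := by
    rintro (n | n) h
    · exact t₁.link_lt n fun h' => h (congrArg _ h')
    · by_cases hn : n = t₂.root
      · subst hn
        simpa using hS
      · simpa only [Sum.elim_inr, if_neg hn] using t₂.link_lt n hn

variable {t₁ t₂ : LabelledTree.{uF, uR, w} L} {S : Set (ℕ × ℕ)}
  {hS : ∀ q ∈ S, q.1 < (t₁.lab t₁.root).1 ∧ q.2 < (t₂.lab t₂.root).1}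

theorem attach_parent_root :
    (attach t₁ S t₂ hS).parent (Sum.inr t₂.root) = Sum.inl t₁.root := if_pos rfl

theorem attach_parent_inr {n : t₂.N} (hn : n ≠ t₂.root) :
    (attach t₁ S t₂ hS).parent (Sum.inr n) = Sum.inr (t₂.parent n) := if_neg hn

theorem attach_link_root : (attach t₁ S t₂ hS).link (Sum.inr t₂.root) = S := if_pos rfl

theorem attach_link_inr {n : t₂.N} (hn : n ≠ t₂.root) :
    (attach t₁ S t₂ hS).link (Sum.inr n) = t₂.link n := if_neg hn

theorem isMatch_attach_iff (f : t₁.N ⊕ t₂.N → tuples L A) :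
    (attach t₁ S t₂ hS).IsMatch f ↔ t₁.IsMatch (fun n => f (Sum.inl n)) ∧
      t₂.IsMatch (fun n => f (Sum.inr n)) ∧
      S ⊆ stp (f (Sum.inl t₁.root)).1.2 (f (Sum.inr t₂.root)).1.2 := by
  constructor
  · rintro ⟨h1, h2⟩
    refine ⟨⟨fun n => h1 (Sum.inl n), fun n hn => h2 (Sum.inl n) fun h => hn (Sum.inl.inj h)⟩,
      ⟨fun n => h1 (Sum.inr n), fun n hn => ?_⟩, ?_⟩
    · have h3 := h2 (Sum.inr n) Sum.inr_ne_inl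
      rwa [attach_parent_inr hn, attach_link_inr hn] at h3
    · have h3 := h2 (Sum.inr t₂.root) Sum.inr_ne_inl
      rwa [attach_parent_root, attach_link_root] at h3
  · rintro ⟨h1, h2, h3⟩
    refine ⟨Sum.rec h1.1 h2.1, ?_⟩
    rintro (n | n) hn
    · exact h1.2 n fun h => hn (congrArg _ h)
    · by_cases h : n = t₂.root
      · subst h
        rw [attach_parent_root, attach_link_root]
        exact h3
      · rw [attach_parent_inr h, attach_link_inr h]
        exact h2.2 n h

variable [Finite (Σ k : ℕ, L.Relations k)] [Finite A]

noncomputable instance : Fintype (tuples L A) := Fintype.ofFinite _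

theorem card_eq_sum_fiber {X : Type*} {Y : Type*} [Finite X] [Fintype Y] (P : X → Prop)
    (f : X → Y) : Nat.card {x // P x} = ∑ y, Nat.card {x // P x ∧ f x = y} := by
  rw [← Nat.card_congr (Equiv.sigmaFiberEquiv fun x : {x // P x} => f x), Nat.card_sigma]
  exact Finset.sum_congr rfl fun y _ => card_subtype_subtype P (fun x => f x = y)

theorem card_match_eq_sum (t : LabelledTree.{uF, uR, w} L) :
    Nat.card {f : t.N → tuples L A // t.IsMatch f} = ∑ x : tuples L A, t.count x :=
  card_eq_sum_fiber _ _

open Classical in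
-- A match splits into independent matches of the two trees, coupled only by the link between their
-- roots.
theorem count_attach (x : tuples L A) : (attach t₁ S t₂ hS).count x =
    t₁.count x * ∑ y : tuples L A, if S ⊆ stp x.1.2 y.1.2 then t₂.count y else 0 := by
  have h1 : (attach t₁ S t₂ hS).count x = Nat.card ({f : t₁.N → tuples L A //
      t₁.IsMatch f ∧ f t₁.root = x} × {f : t₂.N → tuples L A // t₂.IsMatch f ∧
      S ⊆ stp x.1.2 (f t₂.root).1.2}) := by
    refine Nat.card_congr ⟨fun f => ⟨⟨fun n => f.1 (Sum.inl n), ?_⟩,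
      ⟨fun n => f.1 (Sum.inr n), ?_⟩⟩, fun g => ⟨Sum.elim g.1.1 g.2.1, ?_⟩, fun f => ?_,
      fun g => rfl⟩
    · exact ⟨((isMatch_attach_iff _).1 f.2.1).1, f.2.2⟩
    · obtain ⟨-, h1, h2⟩ := (isMatch_attach_iff _).1 f.2.1
      have h3 : f.1 (Sum.inl t₁.root) = x := f.2.2
      rw [h3] at h2
      exact ⟨h1, h2⟩
    · refine ⟨(isMatch_attach_iff _).2 ⟨g.1.2.1, g.2.2.1, ?_⟩, g.1.2.2⟩
      change S ⊆ stp (g.1.1 t₁.root).1.2 (g.2.1 t₂.root).1.2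
      rw [g.1.2.2]
      exact g.2.2.2
    · refine Subtype.ext (funext ?_)
      rintro (n | n) <;> rfl
  rw [h1, Nat.card_prod, card_eq_sum_fiber _ (fun f : t₂.N → tuples L A => f t₂.root)]
  congr 1
  refine Finset.sum_congr rfl fun y _ => ?_
  split_ifs with hy
  · refine Nat.card_congr (Equiv.subtypeEquivRight fun f => ?_)
    exact ⟨fun h => ⟨h.1.1, h.2⟩, fun h => ⟨⟨h.1, h.2 ▸ hy⟩, h.2⟩⟩
  · have : IsEmpty {f : t₂.N → tuples L A // (t₂.IsMatch f ∧
        S ⊆ stp x.1.2 (f t₂.root).1.2) ∧ f t₂.root = y} := ⟨fun f => hy (f.2.2 ▸ f.2.1.2)⟩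
    exact Nat.card_of_isEmpty

end Match

end LabelledTree

namespace LabelledTree

open scoped Classical

/-! ### The span of the count functions -/

section Counts

variable {L : FirstOrder.Language.{uF, uR}}
variable {A : Type u} [L.Structure A] {B : Type v} [L.Structure B]

/-- The pairs of equal positions below `k`. -/
def diag (k : ℕ) : Set (ℕ × ℕ) := {q | q.1 = q.2 ∧ q.1 < k}

theorem atp_eq_of_count_eq {a : tuples L A} {b : tuples L B}
    (h : ∀ t : LabelledTree.{uF, uR, w} L, t.count a = t.count b) :
    atp L a.1.2 = atp L b.1.2 := by
  ext R
  have := h (leaf R)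
  rw [count_leaf, count_leaf] at this
  split_ifs at this with h1 h2 h2 <;> simp_all

variable (A B) in
/-- The count function of a tree on the tuples of both structures. -/
noncomputable def countOn (t : LabelledTree.{uF, uR, w} L) : tuples L A ⊕ tuples L B → ℚ :=
  Sum.elim (fun a => t.count a) (fun b => t.count b)

variable (L A B) in
/-- The linear combinations of count functions. -/
noncomputable def countSpan : Submodule ℚ (tuples L A ⊕ tuples L B → ℚ) :=
  Submodule.span ℚ (Set.range (countOn.{uF, uR, u, v, w} A B))

/-- The two tuples have the same counts for all trees. -/
def SameCounts (x y : tuples L A ⊕ tuples L B) : Prop :=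
  ∀ t : LabelledTree.{uF, uR, w} L, t.countOn A B x = t.countOn A B y

theorem eq_of_sameCounts {x y : tuples L A ⊕ tuples L B}
    (h : SameCounts.{uF, uR, u, v, w} x y) {f : tuples L A ⊕ tuples L B → ℚ}
    (hf : f ∈ countSpan.{uF, uR, u, v, w} L A B) : f x = f y := by
  induction hf using Submodule.span_induction with
  | mem _ hm =>
    obtain ⟨t, rfl⟩ := hm
    exact h t
  | zero => rfl
  | add f g _ _ hf hg => rw [Pi.add_apply, Pi.add_apply, hf, hg]
  | smul c f _ hf => rw [Pi.smul_apply, Pi.smul_apply, hf]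

variable [Finite (Σ k : ℕ, L.Relations k)] [Finite A] [Finite B]

theorem sum_link_eq_zero {t : LabelledTree.{uF, uR, w} L} {x : tuples L A}
    {R : Σ k : ℕ, L.Relations k} (hR : R ∈ atp L x.1.2) {S : Set (ℕ × ℕ)}
    (hS : ¬ ∀ q ∈ S, q.1 < R.1 ∧ q.2 < (t.lab t.root).1) :
    (∑ y : tuples L A, if S ⊆ stp x.1.2 y.1.2 then t.count y else 0) = 0 := by
  refine Finset.sum_eq_zero fun y _ => ?_
  split_ifs with hy
  · refine count_eq_zero fun h => hS fun q hq => ?_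
    obtain ⟨i, j, rfl, -⟩ := hy hq
    rw [length_eq_of_mem_atp hR, length_eq_of_mem_atp h]
    exact ⟨i.2, j.2⟩
  · rfl

theorem count_attach_leaf {t : LabelledTree.{uF, uR, w} L} {x : tuples L A}
    {R : Σ k : ℕ, L.Relations k} (hR : R ∈ atp L x.1.2) {S : Set (ℕ × ℕ)}
    (hS : ∀ q ∈ S, q.1 < R.1 ∧ q.2 < (t.lab t.root).1) :
    (attach (leaf.{uF, uR, w} R) S t hS).count x =
      ∑ y : tuples L A, if S ⊆ stp x.1.2 y.1.2 then t.count y else 0 := by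
  refine (count_attach (t₁ := leaf R) x).trans ?_
  rw [count_leaf, if_pos hR, one_mul]

/-- Linking the roots in all positions forces them onto the same tuple, which leaves only `y = x` in
the sum. -/
theorem count_attach_diag {t₁ t₂ : LabelledTree.{uF, uR, w} L}
    (h : (t₁.lab t₁.root).1 = (t₂.lab t₂.root).1) (x : tuples L A) :
    (attach t₁ (diag (t₁.lab t₁.root).1) t₂ fun _ hq => ⟨hq.2, hq.1 ▸ h ▸ hq.2⟩).count x =
      t₁.count x * t₂.count x := by
  rw [count_attach]
  by_cases hx : t₁.lab t₁.root ∈ atp L x.1.2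
  swap
  · rw [count_eq_zero hx, zero_mul, zero_mul]
  have hk := length_eq_of_mem_atp hx
  congr 1
  rw [Finset.sum_eq_single x, if_pos]
  · rintro ⟨i, j⟩ ⟨hij, hi⟩
    simp only at hij hi
    subst hij
    rw [hk] at hi
    exact mem_stp_iff (i := ⟨i, hi⟩) (j := ⟨i, hi⟩).2 rfl
  · intro y _ hyx
    split_ifs with hy
    · refine count_eq_zero fun hty => hyx (Subtype.ext ?_)
      have hl : y.1.1 = x.1.1 := by
        rw [← hk, h, length_eq_of_mem_atp hty]
      exact tuple_eq_of_stp (a := x.1.2) hl id fun j => hy ⟨rfl, hk.symm ▸ j.2⟩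
    · rfl
  · exact fun h => absurd (Finset.mem_univ x) h

theorem sum_link_eq_of_count_eq {a : tuples L A} {b : tuples L B}
    (h : ∀ t : LabelledTree.{uF, uR, w} L, t.count a = t.count b) (S : Set (ℕ × ℕ))
    (t : LabelledTree.{uF, uR, w} L) :
    (∑ y : tuples L A, if S ⊆ stp a.1.2 y.1.2 then t.count y else 0) =
      ∑ y : tuples L B, if S ⊆ stp b.1.2 y.1.2 then t.count y else 0 := by
  obtain ⟨R, hR⟩ := exists_mem_atp a
  have hR' : R ∈ atp L b.1.2 := atp_eq_of_count_eq h ▸ hR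
  by_cases hS : ∀ q ∈ S, q.1 < R.1 ∧ q.2 < (t.lab t.root).1
  · rw [← count_attach_leaf hR hS, ← count_attach_leaf hR' hS]
    exact h _
  · rw [sum_link_eq_zero hR hS, sum_link_eq_zero hR' hS]

/-- Diagonal attachment handles roots of equal arity. For different arities the product is zero, as
no tuple fits both root labels. -/
theorem mul_mem_countSpan {f g : tuples L A ⊕ tuples L B → ℚ}
    (hf : f ∈ countSpan.{uF, uR, u, v, w} L A B) (hg : g ∈ countSpan.{uF, uR, u, v, w} L A B) :
    f * g ∈ countSpan.{uF, uR, u, v, w} L A B := by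
  have key : countSpan.{uF, uR, u, v, w} L A B * countSpan.{uF, uR, u, v, w} L A B ≤
      countSpan.{uF, uR, u, v, w} L A B := by
    unfold countSpan
    rw [Submodule.span_mul_span, Submodule.span_le]
    rintro _ ⟨_, ⟨t₁, rfl⟩, _, ⟨t₂, rfl⟩, rfl⟩
    by_cases h : (t₁.lab t₁.root).1 = (t₂.lab t₂.root).1
    · refine Submodule.subset_span ⟨attach t₁ (diag (t₁.lab t₁.root).1) t₂
        fun _ hq => ⟨hq.2, hq.1 ▸ h ▸ hq.2⟩, funext ?_⟩
      rintro (x | x)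
      all_goals
        simp only [countOn, Sum.elim_inl, Sum.elim_inr, Pi.mul_apply]
        rw [count_attach_diag h, Nat.cast_mul]
    · have h0 : countOn A B t₁ * countOn A B t₂ = 0 := by
        funext x
        rcases x with x | x
        all_goals
          simp only [countOn, Sum.elim_inl, Sum.elim_inr, Pi.mul_apply, Pi.zero_apply]
          by_cases h1 : t₁.lab t₁.root ∈ atp L x.1.2
          · rw [count_eq_zero (t := t₂) fun h2 =>
              h ((length_eq_of_mem_atp h1).trans (length_eq_of_mem_atp h2).symm),
              Nat.cast_zero, mul_zero]
          · rw [count_eq_zero h1, Nat.cast_zero, zero_mul]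
      change countOn A B t₁ * countOn A B t₂ ∈ Submodule.span ℚ _
      rw [h0]
      exact Submodule.zero_mem _
  exact key (Submodule.mul_mem_mul hf hg)

/-- The indicator function of a class of tuples with the same counts is a linear combination of
count functions. -/
theorem exists_indicator (x₀ : tuples L A ⊕ tuples L B) :
    ∃ f ∈ countSpan.{uF, uR, u, v, w} L A B, ∀ x,
      f x = if SameCounts.{uF, uR, u, v, w} x x₀ then 1 else 0 := by
  suffices h : ∀ T : Finset (tuples L A ⊕ tuples L B),
      (∀ y ∈ T, ¬ SameCounts.{uF, uR, u, v, w} y x₀) →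
      ∃ f ∈ countSpan.{uF, uR, u, v, w} L A B, f x₀ ≠ 0 ∧ ∀ y ∈ T, f y = 0 by
    obtain ⟨f, hf, h0, hy⟩ := h
      (Finset.univ.filter fun y => ¬ SameCounts.{uF, uR, u, v, w} y x₀) (by simp)
    refine ⟨(f x₀)⁻¹ • f, Submodule.smul_mem _ _ hf, fun x => ?_⟩
    rw [Pi.smul_apply, smul_eq_mul]
    split_ifs with hx
    · rw [eq_of_sameCounts hx hf, inv_mul_cancel₀ h0]
    · rw [hy x (by simpa using hx), mul_zero]
  intro T hT
  induction T using Finset.induction_on with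
  | empty =>
    obtain ⟨t, ht⟩ : ∃ t : LabelledTree.{uF, uR, w} L, t.countOn A B x₀ ≠ 0 := by
      rcases x₀ with x | x
      all_goals
        obtain ⟨R, hR⟩ := exists_mem_atp x
        refine ⟨leaf R, ?_⟩
        simp [countOn, count_leaf, hR]
    exact ⟨_, Submodule.subset_span ⟨t, rfl⟩, ht, by simp⟩
  | insert y T _ ih =>
    obtain ⟨f, hf, h0, hfT⟩ := ih fun z hz => hT z (Finset.mem_insert_of_mem hz)
    have hy := hT y (Finset.mem_insert_self _ _)
    simp only [SameCounts, not_forall] at hy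
    obtain ⟨t, ht⟩ := hy
    -- Interpolation: multiply `f` by the count of `t` minus its value at `y`. In expanded form this
    -- needs no constant functions in the span.
    refine ⟨f * t.countOn A B - t.countOn A B y • f, Submodule.sub_mem _
      (mul_mem_countSpan hf (Submodule.subset_span ⟨t, rfl⟩)) (Submodule.smul_mem _ _ hf), ?_, ?_⟩
    · simp only [Pi.sub_apply, Pi.mul_apply, Pi.smul_apply, smul_eq_mul]
      rw [mul_comm, ← sub_mul]
      exact mul_ne_zero (sub_ne_zero.2 (Ne.symm ht)) h0
    · intro z hz
      simp only [Pi.sub_apply, Pi.mul_apply, Pi.smul_apply, smul_eq_mul]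
      obtain rfl | hz := Finset.mem_insert.1 hz
      · ring
      · rw [hfT z hz]
        ring

theorem sum_link_eq {a : tuples L A} {b : tuples L B}
    (h : SameCounts.{uF, uR, u, v, w} (Sum.inl a) (Sum.inr b)) (S : Set (ℕ × ℕ))
    {f : tuples L A ⊕ tuples L B → ℚ} (hf : f ∈ countSpan.{uF, uR, u, v, w} L A B) :
    (∑ y : tuples L A, if S ⊆ stp a.1.2 y.1.2 then f (Sum.inl y) else 0) =
      ∑ y : tuples L B, if S ⊆ stp b.1.2 y.1.2 then f (Sum.inr y) else 0 := by
  induction hf using Submodule.span_induction with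
  | mem _ hm =>
    obtain ⟨t, rfl⟩ := hm
    have := sum_link_eq_of_count_eq (fun t => Nat.cast_injective (h t)) S t
    simp only [countOn, Sum.elim_inl, Sum.elim_inr]
    exact_mod_cast this
  | zero => simp
  | add f g _ _ hf hg =>
    simp only [Pi.add_apply, ← Finset.sum_filter, Finset.sum_add_distrib] at hf hg ⊢
    rw [hf, hg]
  | smul c f _ hf =>
    simp only [Pi.smul_apply, ← Finset.sum_filter, ← Finset.smul_sum] at hf ⊢
    rw [hf]

/-- Summing the counts of a tree over all root tuples gives the number of homomorphisms from its
acyclic structure; linearity does the rest. -/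
theorem sum_eq_of_homIndistinguishable [L.IsRelational] [IsEmpty (L.Relations 0)]
    (h : HomIndistinguishable.{uF, uR, u, v, w} L A B)
    {f : tuples L A ⊕ tuples L B → ℚ} (hf : f ∈ countSpan.{uF, uR, u, v, w} L A B) :
    ∑ y : tuples L A, f (Sum.inl y) = ∑ y : tuples L B, f (Sum.inr y) := by
  induction hf using Submodule.span_induction with
  | mem _ hm =>
    obtain ⟨t, rfl⟩ := hm
    have := h t.Carrier t.covered t.isAcyclic
    rw [card_hom_eq, card_hom_eq, card_match_eq_sum, card_match_eq_sum] at this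
    simp only [countOn, Sum.elim_inl, Sum.elim_inr]
    exact_mod_cast this
  | zero => simp
  | add f g _ _ hf hg =>
    simp only [Pi.add_apply, Finset.sum_add_distrib]
    rw [hf, hg]
  | smul c f _ hf =>
    simp only [Pi.smul_apply, ← Finset.smul_sum]
    rw [hf]

theorem card_eq_sum_ite {X : Type*} [Fintype X] (P Q : X → Prop) :
    (Nat.card {x // P x ∧ Q x} : ℚ) = ∑ x, if P x then (if Q x then 1 else 0) else 0 := by
  rw [Nat.card_eq_fintype_card, Fintype.card_subtype, Finset.card_filter]
  push_cast
  exact Finset.sum_congr rfl fun x _ => by rw [ite_and]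

/-- Neighbor sums of the indicator of the class of `x₀` count its members whose similarity type
contains `T`; invert over inclusion. -/
theorem card_stp_eq_of_sameCounts {a : tuples L A} {b : tuples L B}
    (h : SameCounts.{uF, uR, u, v, w} (Sum.inl a) (Sum.inr b)) (S : Set (ℕ × ℕ))
    (x₀ : tuples L A ⊕ tuples L B) :
    Nat.card {y : tuples L A // SameCounts.{uF, uR, u, v, w} (Sum.inl y) x₀ ∧
      stp a.1.2 y.1.2 = S} =
    Nat.card {y : tuples L B // SameCounts.{uF, uR, u, v, w} (Sum.inr y) x₀ ∧
      stp b.1.2 y.1.2 = S} := by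
  obtain ⟨f, hf, hfx⟩ := exists_indicator x₀
  have key := card_fiber_eq_of_card_upper
    (fun y : {y : tuples L A // SameCounts.{uF, uR, u, v, w} (Sum.inl y) x₀} => stp a.1.2 y.1.1.2)
    (fun y : {y : tuples L B // SameCounts.{uF, uR, u, v, w} (Sum.inr y) x₀} => stp b.1.2 y.1.1.2)
    (fun _ => True) (fun _ _ _ _ => trivial) (fun T _ => by
      rw [card_subtype_subtype (fun y : tuples L A => SameCounts.{uF, uR, u, v, w} (Sum.inl y) x₀)
        (fun y : tuples L A => T ≤ stp a.1.2 y.1.2),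
        card_subtype_subtype (fun y : tuples L B => SameCounts.{uF, uR, u, v, w} (Sum.inr y) x₀)
        (fun y : tuples L B => T ≤ stp b.1.2 y.1.2)]
      have := sum_link_eq h T hf
      simp only [hfx] at this
      rw [← card_eq_sum_ite, ← card_eq_sum_ite] at this
      simpa only [and_comm] using Nat.cast_injective this) S trivial
  rwa [card_subtype_subtype (fun y : tuples L A => SameCounts.{uF, uR, u, v, w} (Sum.inl y) x₀)
    (fun y : tuples L A => stp a.1.2 y.1.2 = S),
    card_subtype_subtype (fun y : tuples L B => SameCounts.{uF, uR, u, v, w} (Sum.inr y) x₀)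
    (fun y : tuples L B => stp b.1.2 y.1.2 = S)] at key

theorem card_eq_of_homIndistinguishable [L.IsRelational] [IsEmpty (L.Relations 0)]
    (h : HomIndistinguishable.{uF, uR, u, v, w} L A B) (x₀ : tuples L A ⊕ tuples L B) :
    Nat.card {y : tuples L A // SameCounts.{uF, uR, u, v, w} (Sum.inl y) x₀} =
    Nat.card {y : tuples L B // SameCounts.{uF, uR, u, v, w} (Sum.inr y) x₀} := by
  obtain ⟨f, hf, hfx⟩ := exists_indicator x₀
  have := sum_eq_of_homIndistinguishable h hf
  simp only [hfx, Finset.sum_boole] at this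
  rw [Nat.card_eq_fintype_card, Nat.card_eq_fintype_card, Fintype.card_subtype,
    Fintype.card_subtype]
  exact_mod_cast this

theorem bisimilar_of_homIndistinguishable [L.IsRelational] [IsEmpty (L.Relations 0)]
    (h : HomIndistinguishable.{uF, uR, u, v, w} L A B) : Bisimilar L A B := by
  -- The vector of all counts labels the classes; vectors that are not attained have empty fibers.
  let κ : tuples L A ⊕ tuples L B → LabelledTree.{uF, uR, w} L → ℚ := fun x t => t.countOn A B x
  have hκ : ∀ x y, κ x = κ y ↔ SameCounts.{uF, uR, u, v, w} x y := fun x y => funext_iff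
  refine ⟨fun a b => SameCounts.{uF, uR, u, v, w} (Sum.inl a) (Sum.inr b), ?_, ?_, ?_⟩
  · exact fun a b hab => atp_eq_of_count_eq fun t => Nat.cast_injective (hab t)
  · intro a b hab
    obtain ⟨σ, hσ⟩ := exists_equiv_of_card_fiber
      (fun y : tuples L A => (κ (Sum.inl y), stp a.1.2 y.1.2))
      (fun y : tuples L B => (κ (Sum.inr y), stp b.1.2 y.1.2)) (by
        rintro ⟨q, S⟩
        simp only [Prod.mk.injEq]
        by_cases hq : ∃ x₀, κ x₀ = q
        · obtain ⟨x₀, rfl⟩ := hq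
          simp only [hκ]
          exact card_stp_eq_of_sameCounts hab S x₀
        · have e1 : IsEmpty {y : tuples L A // κ (Sum.inl y) = q ∧ stp a.1.2 y.1.2 = S} :=
            ⟨fun y => hq ⟨_, y.2.1⟩⟩
          have e2 : IsEmpty {y : tuples L B // κ (Sum.inr y) = q ∧ stp b.1.2 y.1.2 = S} :=
            ⟨fun y => hq ⟨_, y.2.1⟩⟩
          rw [Nat.card_of_isEmpty, Nat.card_of_isEmpty])
    refine ⟨σ, fun y => ?_⟩
    obtain ⟨h1, h2⟩ := Prod.mk_inj.1 (hσ y)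
    exact ⟨h2.symm, (hκ _ _).1 h1.symm⟩
  · obtain ⟨σ, hσ⟩ := exists_equiv_of_card_fiber
      (fun y : tuples L A => κ (Sum.inl y)) (fun y : tuples L B => κ (Sum.inr y)) (by
        intro q
        by_cases hq : ∃ x₀, κ x₀ = q
        · obtain ⟨x₀, rfl⟩ := hq
          simp only [hκ]
          exact card_eq_of_homIndistinguishable h x₀
        · have e1 : IsEmpty {y : tuples L A // κ (Sum.inl y) = q} := ⟨fun y => hq ⟨_, y.2⟩⟩
          have e2 : IsEmpty {y : tuples L B // κ (Sum.inr y) = q} := ⟨fun y => hq ⟨_, y.2⟩⟩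
          rw [Nat.card_of_isEmpty, Nat.card_of_isEmpty])
    exact ⟨σ, fun y => (hκ _ _).1 (hσ y).symm⟩

end Counts

end LabelledTree

end RCR

/-! ### The equivalence -/

theorem theoremD (L : FirstOrder.Language.{uF, uR}) [L.IsRelational]
    [Finite (Σ k : ℕ, L.Relations k)] [Nonempty (Σ k : ℕ, L.Relations k)] [IsEmpty (L.Relations 0)]
    (A : Type u) [L.Structure A] [Finite A] [Nonempty A] (hA : RCR.Covered L A)
    (B : Type v) [L.Structure B] [Finite B] [Nonempty B] (hB : RCR.Covered L B) :
    List.TFAE [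
      ¬ RCR.Distinguishes L A B,
      RCR.HomIndistinguishable.{uF, uR, u, v, w} L A B,
      RCR.GuardedEquivalent L A B,
      RCR.DuplicatorWins L A B] := by
  have h1 : ¬ RCR.Distinguishes L A B → RCR.Bisimilar L A B :=
    RCR.bisimilar_of_not_distinguishes
  tfae_have 1 → 2 := fun h => (h1 h).homIndistinguishable
  tfae_have 2 → 1 := fun h =>
    (RCR.LabelledTree.bisimilar_of_homIndistinguishable h).not_distinguishes
  tfae_have 1 → 3 := fun h => (h1 h).guardedEquivalent
  tfae_have 3 → 1 := fun h => h.not_distinguishes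
  tfae_have 1 → 4 := fun h => (h1 h).duplicatorWins
  tfae_have 4 → 1 := fun h => h.not_distinguishes
  tfae_finish
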